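/- Continuous logic conventions. A language has (possibly many) sorts with bounded metrics, function symbols and real-valued predicate symbols, each symbol with a continuity modulus, and each predicate symbol with a compact interval of values; a structure interprets the sorts as non-empty complete metric spaces and respects these data. Continuous formulas are built from the atomic formulas $P(t_1,\dots,t_n)$ and $d(t,t')$ using arbitrary continuous connectives $\mathbb R^k\to\mathbb R$ and the quantifiers $\sup$, $\inf$ over one variable; a formula is affine if all its connectives are affine functions. An elementary (respectively, affine) extension $N$ of $M$ is an extension such that every continuous (respectively, affine) formula with parameters in $M$ has the same value in $M$ and in $N$. Let $M$ be a structure and $\varphi(x,y)$ a formula in two disjoint tuples of variables; put $\varphi^{\mathrm{op}}(y,x)=\varphi(x,y)$. A continuous (respectively, affine) $\varphi$-type over $M$ is the map $p$ assigning to each instance $\varphi(x,b)$, $b\in M^y$, the value $\varphi(x,b)^p=\varphi(a,b)^N$, for some $a\in N^x$ in some elementary (respectively, affine) extension $N$ of $M$; write $dp\colon M^y\to\mathbb R$, $dp(b)=\varphi(x,b)^p$. Let $S^{\mathrm{cont}}_\varphi(M)$ and $S^{\mathrm{aff}}_\varphi(M)$ be the sets of these types, with the topology of pointwise convergence. For a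 function $\psi\colon M^x\to\mathbb R$ say that: - $\psi$ is a definable $\varphi$-predicate if it is induced, through $a\mapsto \mathrm{tp}_\varphi(a/M)$, by a continuous function on $S^{\mathrm{cont}}_\varphi(M)$; this function is unique, and $\psi(p)$ denotes its value at $p\in S^{\mathrm{cont}}_\varphi(M)$; - $\psi$ is an affine $\varphi$-predicate if it is a uniform limit of functions $\theta=c+\sum_{i<n}\alpha_i\varphi(x,b_i)$ with $c,\alpha_i\in\mathbb R$ and $b_i\in M^y$; for $p\in S^{\mathrm{aff}}_\varphi(M)$, $\psi(p)$ denotes the limit of the values $c+\sum_{i<n}\alpha_i\varphi(x,b_i)^p$ as $\theta\to\psi$ uniformly; - $\psi$ is a mean $\varphi$-predicate if it is a uniform limit of convex combinations of functions $\varphi(x,b)$, $b\in M^y$. A type $p$ in $S^{\mathrm{cont}}_\varphi(M)$ (respectively, $S^{\mathrm{aff}}_\varphi(M)$) is $\varphi^{\mathrm{op}}$-definable (respectively, affinely $\varphi^{\mathrm{op}}$-definable) if $dp$ is a definable (respectively, affine) $\varphi^{\mathrm{op}}$-predicate, and mean-definable if $dp$ is a mean $\varphi^{\mathrm{op}}$-predicate;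 similarly with $\varphi$ and $\varphi^{\mathrm{op}}$ exchanged. Theorem (Stability in a model and definability of types). Let $M$ be a structure. The following are equivalent for a continuous formula $\varphi(x,y)$: 1. $\varphi$ is stable in $M$: for all sequences $(a_n)$ in $M^x$ and $(b_m)$ in $M^y$, $\lim_n\lim_m\varphi(a_n,b_m)=\lim_m\lim_n\varphi(a_n,b_m)$ whenever all the limits exist. 2. Every $p\in S^{\mathrm{cont}}_\varphi(M)$ is $\varphi^{\mathrm{op}}$-definable, every $q\in S^{\mathrm{cont}}_{\varphi^{\mathrm{op}}}(M)$ is $\varphi$-definable, and $dp(q)=dq(p)$ for all such $p,q$. 3. Every $p\in S^{\mathrm{cont}}_\varphi(M)$ and every $q\in S^{\mathrm{cont}}_{\varphi^{\mathrm{op}}}(M)$ is mean-definable. If moreover $\varphi$ is an affine formula, these conditions are further equivalent to each of the following: 4. Every $p\in S^{\mathrm{aff}}_\varphi(M)$ is affinely $\varphi^{\mathrm{op}}$-definable, every $q\in S^{\mathrm{aff}}_{\varphi^{\mathrm{op}}}(M)$ is affinely $\varphi$-definable, and $dp(q)=dq(p)$ for all such $p,q$. 5. Every $p\in S^{\mathrm{aff}}_\varphi(M)$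 and every $q\in S^{\mathrm{aff}}_{\varphi^{\mathrm{op}}}(M)$ is mean-definable. -/

import Mathlib

open Filter Topology
open scoped NNReal

universe l v w

namespace ContLogic

/-! ### Languages and structures of (many-sorted) continuous logic -/

/-- A continuity modulus in `n` arguments. -/
structure Modulus (n : ℕ) where
  toFun : (Fin n → ℝ≥0) → ℝ≥0
  continuous_toFun : Continuous toFun
  monotone_toFun : Monotone toFun
  map_zero : toFun 0 = 0

/-- A language: sorts, each with a bound for its diameter; function symbols, each with its sorts and
a continuity modulus; predicate symbols, each with its sorts, a continuity modulus and a compact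
interval of values. The metric of every sort is always part of the language. -/
structure Language where
  sorts : Type l
  diam : sorts → ℝ
  Fun : Type l
  funArity : Fun → ℕ
  funDom : (F : Fun) → Fin (funArity F) → sorts
  funCod : Fun → sorts
  funModulus : (F : Fun) → Modulus (funArity F)
  Pred : Type l
  predArity : Pred → ℕ
  predDom : (P : Pred) → Fin (predArity P) → sorts
  predModulus : (P : Pred) → Modulus (predArity P)
  predLo : Pred → ℝ
  predHi : Pred → ℝ

/-- An `L`-structure: a nonempty complete bounded metric space for every sort, together with
interpretations of the symbols that respect the prescribed moduli and bounds. -/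
structure Structure (L : Language.{l}) where
  carrier : L.sorts → Type w
  metric : ∀ s, MetricSpace (carrier s)
  complete : ∀ s, CompleteSpace (carrier s)
  nonempty : ∀ s, Nonempty (carrier s)
  dist_le : ∀ (s) (a b : carrier s), dist a b ≤ L.diam s
  funMap : (F : L.Fun) → (∀ i, carrier (L.funDom F i)) → carrier (L.funCod F)
  funMap_modulus : ∀ (F : L.Fun) (a b : ∀ i, carrier (L.funDom F i)),
    nndist (funMap F a) (funMap F b) ≤ (L.funModulus F).toFun (fun i => nndist (a i) (b i))
  predMap : (P : L.Pred) → (∀ i, carrier (L.predDom P i)) → ℝ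
  predMap_modulus : ∀ (P : L.Pred) (a b : ∀ i, carrier (L.predDom P i)),
    nndist (predMap P a) (predMap P b) ≤ (L.predModulus P).toFun (fun i => nndist (a i) (b i))
  predMap_mem : ∀ (P : L.Pred) (a : ∀ i, carrier (L.predDom P i)),
    predMap P a ∈ Set.Icc (L.predLo P) (L.predHi P)

attribute [instance] Structure.metric Structure.complete Structure.nonempty

variable {L : Language.{l}}

/-- For a tuple of variables `x` (an index set `V` with a sort for each index),
`M.Tuple x` is the set `M^x`. -/
abbrev Structure.Tuple (M : Structure.{l, w} L) {V : Type v} (x : V → L.sorts) : Type (max v w) :=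
  ∀ i, M.carrier (x i)

/-! ### Terms and formulas -/

/-- The tuple of variables `x` with one more variable, `none`, of sort `s`. -/
abbrev addVar {V : Type v} (s : L.sorts) (x : V → L.sorts) : Option V → L.sorts :=
  fun o => o.elim s x

/-- Terms in the variables `x`, by sort. -/
inductive Term (L : Language.{l}) {V : Type v} (x : V → L.sorts) : L.sorts → Type (max l v)
  | var (i : V) : Term L x (x i)
  | app (F : L.Fun) (t : ∀ i, Term L x (L.funDom F i)) : Term L x (L.funCod F)

/-- Continuous logic formulas in the variables `x`: built from atomic formulas (predicates and
distances of terms) with all continuous functions `ℝ^k → ℝ` as connectives and with `sup` and `inf`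
over one variable as quantifiers. -/
inductive Formula (L : Language.{l}) : {V : Type v} → (V → L.sorts) → Type (max l (v + 1))
  | pred {V : Type v} {x : V → L.sorts} (P : L.Pred) (t : ∀ i, Term L x (L.predDom P i)) :
      Formula L x
  | dist {V : Type v} {x : V → L.sorts} {s : L.sorts} (t t' : Term L x s) : Formula L x
  | conn {V : Type v} {x : V → L.sorts} {k : ℕ} (u : C(Fin k → ℝ, ℝ)) (φ : Fin k → Formula L x) :
      Formula L x
  | sup {V : Type v} {x : V → L.sorts} (s : L.sorts) (φ : Formula L (addVar s x)) : Formula L x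
  | inf {V : Type v} {x : V → L.sorts} (s : L.sorts) (φ : Formula L (addVar s x)) : Formula L x

/-- Affine formulas: those in which every connective is an affine function. -/
def Formula.IsAffine : ∀ {V : Type v} {x : V → L.sorts}, Formula L x → Prop
  | _, _, .pred _ _ => True
  | _, _, .dist _ _ => True
  | _, _, @Formula.conn _ _ _ k u φ =>
      (∃ (c : ℝ) (α : Fin k → ℝ), ∀ t, u t = c + ∑ i, α i * t i) ∧ ∀ i, (φ i).IsAffine
  | _, _, .sup _ φ => φ.IsAffine
  | _, _, .inf _ φ => φ.IsAffine

/-! ### Interpretation -/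

def Structure.cons (M : Structure.{l, w} L) {V : Type v} {x : V → L.sorts} {s : L.sorts}
    (a : M.carrier s) (e : M.Tuple x) : M.Tuple (addVar s x)
  | none => a
  | some i => e i

/-- The concatenation of two tuples. -/
def Structure.append (M : Structure.{l, w} L) {V W : Type v} {x : V → L.sorts} {y : W → L.sorts}
    (a : M.Tuple x) (b : M.Tuple y) : M.Tuple (Sum.elim x y)
  | .inl i => a i
  | .inr j => b j

def Term.eval (M : Structure.{l, w} L) {V : Type v} {x : V → L.sorts} (e : M.Tuple x) :
    ∀ {s : L.sorts}, Term L x s → M.carrier s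
  | _, .var i => e i
  | _, .app F t => M.funMap F (fun i => (t i).eval M e)

/-- The value `φ(e)^M`. -/
noncomputable def Formula.eval (M : Structure.{l, w} L) :
    ∀ {V : Type v} {x : V → L.sorts}, Formula L x → M.Tuple x → ℝ
  | _, _, .pred P t, e => M.predMap P (fun i => (t i).eval M e)
  | _, _, .dist t t', e => Dist.dist (t.eval M e) (t'.eval M e)
  | _, _, .conn u φ, e => u (fun i => (φ i).eval M e)
  | _, _, .sup s φ, e => ⨆ a : M.carrier s, φ.eval M (M.cons a e)
  | _, _, .inf s φ, e => ⨅ a : M.carrier s, φ.eval M (M.cons a e)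

/-- Formulas take their values in a compact interval that does not depend on the structure; in
particular the suprema and infima above are those of nonempty bounded sets. -/
theorem Formula.exists_bound {V : Type v} {x : V → L.sorts} (φ : Formula L x) :
    ∃ C : ℝ, ∀ (M : Structure.{l, w} L) (e : M.Tuple x), |φ.eval M e| ≤ C := by
  induction φ with
  | pred P t =>
    refine ⟨max |L.predLo P| |L.predHi P|, fun M e => ?_⟩
    obtain ⟨h1, h2⟩ := M.predMap_mem P (fun i => (t i).eval M e)
    exact abs_le_max_abs_abs h1 h2
  | @dist V x s t t' =>
    refine ⟨L.diam s, fun M e => ?_⟩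
    simpa [Formula.eval, abs_of_nonneg] using M.dist_le s (t.eval M e) (t'.eval M e)
  | conn u φ ih =>
    choose C hC using ih
    obtain ⟨D, hD⟩ := ((isCompact_univ_pi fun i =>
      isCompact_Icc (a := -C i) (b := C i)).image u.continuous).isBounded.exists_norm_le
    exact ⟨D, fun M e => hD _ ⟨_, fun i _ => abs_le.1 (hC i M e), rfl⟩⟩
  | sup s φ ih =>
    obtain ⟨C, hC⟩ := ih
    refine ⟨C, fun M e => abs_le.2 ⟨?_, ciSup_le fun a => (abs_le.1 (hC M (M.cons a e))).2⟩⟩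
    obtain ⟨a⟩ := M.nonempty s
    exact (abs_le.1 (hC M (M.cons a e))).1.trans (le_ciSup
      (f := fun a => φ.eval M (M.cons a e))
      ⟨C, by rintro _ ⟨a, rfl⟩; exact (abs_le.1 (hC M (M.cons a e))).2⟩ a)
  | inf s φ ih =>
    obtain ⟨C, hC⟩ := ih
    refine ⟨C, fun M e => abs_le.2 ⟨le_ciInf fun a => (abs_le.1 (hC M (M.cons a e))).1, ?_⟩⟩
    obtain ⟨a⟩ := M.nonempty s
    exact (ciInf_le (f := fun a => φ.eval M (M.cons a e))
      ⟨-C, by rintro _ ⟨a, rfl⟩; exact (abs_le.1 (hC M (M.cons a e))).1⟩ a).trans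
      (abs_le.1 (hC M (M.cons a e))).2

/-! ### Elementary and affine extensions -/

/-- `e : M → N` makes `N` an elementary extension of `M` in continuous logic: every continuous
formula with parameters in `M` has the same value in `M` and in `N`. (Applied to atomic formulas,
this says in particular that `e` is an isometric embedding of structures.) -/
def IsElementary (M N : Structure.{l, w} L) (e : ∀ s, M.carrier s → N.carrier s) : Prop :=
  ∀ {V : Type v} (z : V → L.sorts) (θ : Formula L z) (a : M.Tuple z),
    θ.eval N (fun i => e _ (a i)) = θ.eval M a

/-- `e : M → N` makes `N` an affine extension of `M`: every affine formula with parameters in `M`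
has the same value in `M` and in `N`. -/
def IsAffineExtension (M N : Structure.{l, w} L) (e : ∀ s, M.carrier s → N.carrier s) : Prop :=
  ∀ {V : Type v} (z : V → L.sorts) (θ : Formula L z), θ.IsAffine → ∀ a : M.Tuple z,
    θ.eval N (fun i => e _ (a i)) = θ.eval M a

/-! ### Local types, for a formula with two distinguished tuples of variables -/

section

variable {V W : Type v} {x : V → L.sorts} {y : W → L.sorts}

/-- A formula `φ(x,y)` seen through its interpretations `N^x × N^y → ℝ` in all structures `N`. -/
abbrev Interp (x : V → L.sorts) (y : W → L.sorts) :=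
  ∀ N : Structure.{l, w} L, N.Tuple x → N.Tuple y → ℝ

/-- The interpretation of a formula `φ(x,y)`. -/
noncomputable def Formula.interp (φ : Formula L (Sum.elim x y)) : Interp.{l, v, w} x y :=
  fun N a b => φ.eval N (N.append a b)

/-- `φ^op(y,x) = φ(x,y)`. -/
def Interp.op (φ : Interp.{l, v, w} x y) : Interp.{l, v, w} y x := fun N b a => φ N a b

/-- `φ` is stable in `M`: `lim_n lim_m φ(a_n,b_m) = lim_m lim_n φ(a_n,b_m)` whenever all the limits
exist. -/
def IsStable (φ : Interp.{l, v, w} x y) (M : Structure.{l, w} L) : Prop :=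
  ∀ (a : ℕ → M.Tuple x) (b : ℕ → M.Tuple y) (f g : ℕ → ℝ) (r s : ℝ),
    (∀ n, Tendsto (fun m => φ M (a n) (b m)) atTop (𝓝 (f n))) → Tendsto f atTop (𝓝 r) →
    (∀ m, Tendsto (fun n => φ M (a n) (b m)) atTop (𝓝 (g m))) → Tendsto g atTop (𝓝 s) →
    r = s

/-- The space of continuous `φ`-types over `M`: the `φ`-types over `M` realised in elementary
extensions of `M`. The type `p` of `a` is the map which sends the instance `φ(x,b)`, `b ∈ M^y`, to
`φ(x,b)^p = φ(a,b)`. Instances are indexed by `b`, so that `p` and the function `dp : M^y → ℝ` are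
the same thing. -/
def contTypes (φ : Interp.{l, v, w} x y) (M : Structure.{l, w} L) : Set (M.Tuple y → ℝ) :=
  {p | ∃ (N : Structure.{l, w} L) (e : ∀ s, M.carrier s → N.carrier s),
    IsElementary.{l, v, w} M N e ∧ ∃ a : N.Tuple x, ∀ b, p b = φ N a (fun j => e _ (b j))}

/-- The space of affine `φ`-types over `M`: the `φ`-types over `M` realised in affine extensions
of `M`. -/
def affTypes (φ : Interp.{l, v, w} x y) (M : Structure.{l, w} L) : Set (M.Tuple y → ℝ) :=
  {p | ∃ (N : Structure.{l, w} L) (e : ∀ s, M.carrier s → N.carrier s),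
    IsAffineExtension.{l, v, w} M N e ∧ ∃ a : N.Tuple x, ∀ b, p b = φ N a (fun j => e _ (b j))}

/-! ### Predicates on `M^x` defined through `φ` -/

/-- `f` is continuous on the space of continuous `φ`-types (with the topology of pointwise
convergence) and induces the function `ψ` on `M^x`, via `a ↦ tp_φ(a/M)`. -/
def ContExtends (φ : Interp.{l, v, w} x y) (M : Structure.{l, w} L) (ψ : M.Tuple x → ℝ)
    (f : (M.Tuple y → ℝ) → ℝ) : Prop :=
  ContinuousOn f (contTypes φ M) ∧ ∀ a, f (φ M a) = ψ a

/-- `ψ` is a definable `φ`-predicate on `M`, i.e., it is given by a continuous function on the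
space of continuous `φ`-types. -/
def IsContPredicate (φ : Interp.{l, v, w} x y) (M : Structure.{l, w} L) (ψ : M.Tuple x → ℝ) :
    Prop :=
  ∃ f, ContExtends φ M ψ f

/-- The definable `φ`-predicate `ψ` takes the value `r` at the continuous `φ`-type `p`. (The value
is unique, as types realised in `M` are dense.) -/
def ContValue (φ : Interp.{l, v, w} x y) (M : Structure.{l, w} L) (ψ : M.Tuple x → ℝ)
    (p : M.Tuple y → ℝ) (r : ℝ) : Prop :=
  ∃ f, ContExtends φ M ψ f ∧ f p = r

/-- `ψ` is an affine `φ`-predicate on `M`: a uniform limit of affine combinations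
`c + ∑ i, α i * φ(x, b i)` of `M`-instances of `φ`. -/
def IsAffPredicate (φ : Interp.{l, v, w} x y) (M : Structure.{l, w} L) (ψ : M.Tuple x → ℝ) :
    Prop :=
  ∀ ε > 0, ∃ (n : ℕ) (c : ℝ) (α : Fin n → ℝ) (b : Fin n → M.Tuple y),
    ∀ a, |ψ a - (c + ∑ i, α i * φ M a (b i))| ≤ ε

/-- The affine `φ`-predicate `ψ` takes the value `r` at the affine `φ`-type `p`: affine combinations
of instances that converge uniformly to `ψ` converge to `r` at `p`. (The value is unique: an affine
combination of instances that is bounded by `ε` on `M^x` is bounded by `ε` at every affine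
`φ`-type.) -/
def AffValue (φ : Interp.{l, v, w} x y) (M : Structure.{l, w} L) (ψ : M.Tuple x → ℝ)
    (p : M.Tuple y → ℝ) (r : ℝ) : Prop :=
  ∀ ε > 0, ∃ (n : ℕ) (c : ℝ) (α : Fin n → ℝ) (b : Fin n → M.Tuple y),
    (∀ a, |ψ a - (c + ∑ i, α i * φ M a (b i))| ≤ ε) ∧ |r - (c + ∑ i, α i * p (b i))| ≤ ε

/-- `ψ` is a mean `φ`-predicate on `M`: a uniform limit of convex combinations of `M`-instances
of `φ`. -/
def IsMeanPredicate (φ : Interp.{l, v, w} x y) (M : Structure.{l, w} L) (ψ : M.Tuple x → ℝ) :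
    Prop :=
  ∀ ε > 0, ∃ (n : ℕ) (α : Fin n → ℝ) (b : Fin n → M.Tuple y),
    (∀ i, 0 ≤ α i) ∧ ∑ i, α i = 1 ∧ ∀ a, |ψ a - ∑ i, α i * φ M a (b i)| ≤ ε

/-! ### Definability conditions on types -/

/-- Every continuous `φ`-type `p` over `M` is `φ^op`-definable (`dp` is a definable
`φ^op`-predicate), every continuous `φ^op`-type `q` over `M` is `φ`-definable, and
`dp(q) = dq(p)`. -/
def ContTypesDefinableSymm (φ : Interp.{l, v, w} x y) (M : Structure.{l, w} L) : Prop :=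
  (∀ p ∈ contTypes φ M, IsContPredicate φ.op M p) ∧
  (∀ q ∈ contTypes φ.op M, IsContPredicate φ M q) ∧
  ∀ p ∈ contTypes φ M, ∀ q ∈ contTypes φ.op M,
    ∃ r, ContValue φ.op M p q r ∧ ContValue φ M q p r

/-- All continuous `φ`-types and `φ^op`-types over `M` are mean-definable. -/
def ContTypesMeanDefinable (φ : Interp.{l, v, w} x y) (M : Structure.{l, w} L) : Prop :=
  (∀ p ∈ contTypes φ M, IsMeanPredicate φ.op M p) ∧
  ∀ q ∈ contTypes φ.op M, IsMeanPredicate φ M q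

/-- Every affine `φ`-type `p` over `M` is affinely `φ^op`-definable (`dp` is an affine
`φ^op`-predicate), every affine `φ^op`-type `q` over `M` is affinely `φ`-definable, and
`dp(q) = dq(p)`. -/
def AffTypesDefinableSymm (φ : Interp.{l, v, w} x y) (M : Structure.{l, w} L) : Prop :=
  (∀ p ∈ affTypes φ M, IsAffPredicate φ.op M p) ∧
  (∀ q ∈ affTypes φ.op M, IsAffPredicate φ M q) ∧
  ∀ p ∈ affTypes φ M, ∀ q ∈ affTypes φ.op M,
    ∃ r, AffValue φ.op M p q r ∧ AffValue φ M q p r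

/-- All affine `φ`-types and `φ^op`-types over `M` are mean-definable. -/
def AffTypesMeanDefinable (φ : Interp.{l, v, w} x y) (M : Structure.{l, w} L) : Prop :=
  (∀ p ∈ affTypes φ M, IsMeanPredicate φ.op M p) ∧
  ∀ q ∈ affTypes φ.op M, IsMeanPredicate φ M q

end

end ContLogic

/-! The core is that stability implies mean-definability, which is pure analysis of a bounded
function `φ` on a product subject to Grothendieck's double limit condition. The condition survives
convex combinations (`DoubleLimit.on_convexHull`): these are probability measures on a Stone–Čech
compactification, where dominated convergence exchanges the limits. If `φ(a, ·)` tends pointwise to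
`p`, then `|φ - p|` satisfies the condition too and tends to zero; were none of its convex
combinations uniformly small, a minimax argument would produce sequences with one iterated limit
zero and the other at least `ε` (`DoubleLimit.exists_convexHull_le`). Hence pointwise limits of
convex combinations are uniform limits of convex combinations
(`DoubleLimit.exists_abs_sub_le_of_mem_closure`).

Logic serves to locate the types. A continuous type is a pointwise limit of types of points of `M`
(`mem_closure_of_mem_contTypes`). For an affine formula only affine tests are preserved by the
extension, and Hahn–Banach puts an affine type in the closed convex hull of the types of points
(`mem_closure_convexHull_of_mem_affTypes`). So both kinds of types are mean-definable under
stability.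

For the way back, if `p` and `q` are mean-definable, then `dp(q)` and `dq(p)` are approximated by
the same double sums `∑ αᵢ βⱼ φ(aᵢ, bⱼ)`, hence agree (`exists_affValue_of_isMeanPredicate`).
Finally, given sequences in `M`, their limit types along an ultrafilter are realised in an
ultrapower (`mem_contTypes_of_tendsto`), and the two iterated limits are `dq(p)` and `dp(q)`;
symmetry gives stability. -/

namespace ContLogic

/-! ### Double limits of bounded functions on a product -/

section DoubleLimit

variable {X Y : Type*}

/-- The iterated limits of `φ` along sequences agree whenever they exist. -/
def DoubleLimit (φ : X → Y → ℝ) : Prop :=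
  ∀ (a : ℕ → X) (b : ℕ → Y) (f g : ℕ → ℝ) (r s : ℝ),
    (∀ n, Tendsto (fun m => φ (a n) (b m)) atTop (𝓝 (f n))) → Tendsto f atTop (𝓝 r) →
    (∀ m, Tendsto (fun n => φ (a n) (b m)) atTop (𝓝 (g m))) → Tendsto g atTop (𝓝 s) →
    r = s

theorem DoubleLimit.comp {φ : X → Y → ℝ} (h : DoubleLimit φ) {X' Y' : Type*} (u : X' → X)
    (v : Y' → Y) : DoubleLimit fun a b => φ (u a) (v b) :=
  fun a b f g r s => h (u ∘ a) (v ∘ b) f g r s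

theorem DoubleLimit.flip {φ : X → Y → ℝ} (h : DoubleLimit φ) :
    DoubleLimit fun b a => φ a b :=
  fun a b f g r s h1 h2 h3 h4 => (h b a g f s r h3 h4 h1 h2).symm

/-- Iterated limits along arbitrary filters agree. -/
theorem DoubleLimit.exchange {φ : X → Y → ℝ} (h : DoubleLimit φ) {U : Filter X} [U.NeBot]
    {V : Filter Y} [V.NeBot] {p : Y → ℝ} {q : X → ℝ} {r s : ℝ}
    (hp : ∀ b, Tendsto (fun a => φ a b) U (𝓝 (p b)))
    (hq : ∀ a, Tendsto (fun b => φ a b) V (𝓝 (q a)))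
    (hr : Tendsto q U (𝓝 r)) (hs : Tendsto p V (𝓝 s)) : r = s := by
  classical
  have hpos : ∀ k : ℕ, (0 : ℝ) < 1 / (k + 1) := fun k => Nat.one_div_pos_of_nat
  -- Each new pair must be good against all earlier ones. The third coordinate is a strictly
  -- increasing counter that forces the errors to zero.
  obtain ⟨c, hc, hc'⟩ := exists_seq_of_forall_finset_exists (α := X × Y × ℕ)
    (fun c => |q c.1 - r| < 1 / ((c.2.2 : ℝ) + 1) ∧ |p c.2.1 - s| < 1 / ((c.2.2 : ℝ) + 1))
    (fun c c' => c.2.2 < c'.2.2 ∧ |φ c'.1 c.2.1 - p c.2.1| < 1 / ((c'.2.2 : ℝ) + 1) ∧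
      |φ c.1 c'.2.1 - q c.1| < 1 / ((c'.2.2 : ℝ) + 1)) (by
    intro S _
    set k := S.sup (fun c => c.2.2) + 1 with hk
    have h1 := (Metric.tendsto_nhds.1 hr _ (hpos k)).and
      ((Filter.eventually_all_finset S).2 fun c _ => Metric.tendsto_nhds.1 (hp c.2.1) _ (hpos k))
    have h2 := (Metric.tendsto_nhds.1 hs _ (hpos k)).and
      ((Filter.eventually_all_finset S).2 fun c _ => Metric.tendsto_nhds.1 (hq c.1) _ (hpos k))
    obtain ⟨a, ha⟩ := h1.exists
    obtain ⟨b, hb⟩ := h2.exists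
    refine ⟨(a, b, k), ⟨ha.1, hb.1⟩, fun c hcS => ⟨?_, ha.2 c hcS, hb.2 c hcS⟩⟩
    exact Nat.lt_succ_of_le (Finset.le_sup (f := fun c : X × Y × ℕ => c.2.2) hcS))
  have hmono : StrictMono fun n => (c n).2.2 := fun m n hmn => (hc' m n hmn).1
  have hlim : Tendsto (fun n => 1 / (((c n).2.2 : ℝ) + 1)) atTop (𝓝 0) :=
    tendsto_one_div_add_atTop_nhds_zero_nat.comp hmono.tendsto_atTop
  have key : ∀ (u : ℕ → ℝ) (t : ℝ), (∀ᶠ n in atTop, |u n - t| < 1 / (((c n).2.2 : ℝ) + 1)) →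
      Tendsto u atTop (𝓝 t) := fun u t hu =>
    tendsto_iff_dist_tendsto_zero.2 (squeeze_zero' (Eventually.of_forall fun _ => dist_nonneg)
      (hu.mono fun n hn => hn.le) hlim)
  refine h (fun n => (c n).1) (fun n => (c n).2.1) (fun n => q (c n).1) (fun n => p (c n).2.1) r s
    (fun n => key _ _ ?_) (key _ _ (Eventually.of_forall fun n => (hc n).1))
    (fun n => key _ _ ?_) (key _ _ (Eventually.of_forall fun n => (hc n).2))
  · filter_upwards [eventually_gt_atTop n] with m hm using (hc' n m hm).2.2
  · filter_upwards [eventually_gt_atTop n] with m hm using (hc' n m hm).2.1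

/-- Compactness of `[-C, C]`; this lets ultrafilter limits replace repeated passage to subsequences.
-/
theorem exists_tendsto_of_bounded (U : Ultrafilter X) {f : X → ℝ} {C : ℝ}
    (hf : ∀ a, |f a| ≤ C) : ∃ t, |t| ≤ C ∧ Tendsto f U (𝓝 t) := by
  obtain ⟨t, ht, hU⟩ := isCompact_iff_ultrafilter_le_nhds.1 (isCompact_Icc (a := -C) (b := C))
    (U.map f) (by
      rw [le_principal_iff]
      exact Filter.mem_map.2 (Filter.univ_mem' fun a => abs_le.1 (hf a)))
  exact ⟨t, abs_le.2 ht, hU⟩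

/-- The double limit property of `φ` passes to `|φ(a,b) - p(b)|`. -/
theorem DoubleLimit.abs_sub {φ : X → Y → ℝ} (h : DoubleLimit φ) {C : ℝ} (hC : ∀ a b, |φ a b| ≤ C)
    {p : Y → ℝ} (hp : ∀ b, |p b| ≤ C) : DoubleLimit fun a b => |φ a b - p b| := by
  intro a b f g r s hf hr hg hs
  have hW : (hyperfilter ℕ : Filter ℕ) ≤ atTop := Nat.hyperfilter_le_atTop
  -- Only the limits of `|φ - p|` are given; `φ` and `p` separately may diverge along the sequences,
  -- but they converge along an ultrafilter.
  choose q hq1 hq using fun n =>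
    exists_tendsto_of_bounded (hyperfilter ℕ) (f := fun m => φ (a n) (b m)) (fun m => hC _ _)
  choose p' hp1 hp' using fun m =>
    exists_tendsto_of_bounded (hyperfilter ℕ) (f := fun n => φ (a n) (b m)) (fun m => hC _ _)
  obtain ⟨π, -, hπ⟩ := exists_tendsto_of_bounded (hyperfilter ℕ) (f := fun m => p (b m))
    (fun m => hp _)
  obtain ⟨ρ, -, hρ⟩ := exists_tendsto_of_bounded (hyperfilter ℕ) hq1
  obtain ⟨σ, -, hσ⟩ := exists_tendsto_of_bounded (hyperfilter ℕ) hp1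
  have e : ρ = σ := (h.comp a b).exchange hp' hq hρ hσ
  have hf' : f = fun n => |q n - π| := funext fun n =>
    tendsto_nhds_unique ((hf n).mono_left hW) ((hq n).sub hπ).abs
  have hg' : g = fun m => |p' m - p (b m)| := funext fun m =>
    tendsto_nhds_unique ((hg m).mono_left hW) ((hp' m).sub tendsto_const_nhds).abs
  have h1 := tendsto_nhds_unique (hr.mono_left hW) (hf' ▸ (hρ.sub tendsto_const_nhds).abs)
  have h2 := tendsto_nhds_unique (hs.mono_left hW) (hg' ▸ (hσ.sub hπ).abs)
  rw [h1, h2, e]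

end DoubleLimit

/-! ### Convex combinations -/

section Convex

variable {X Y : Type*}

theorem mem_convexHull_range_iff {E : Type*} [AddCommGroup E] [Module ℝ E] {φ : X → E} {θ : E} :
    θ ∈ convexHull ℝ (Set.range φ) ↔ ∃ (n : ℕ) (α : Fin n → ℝ) (a : Fin n → X),
      (∀ i, 0 ≤ α i) ∧ ∑ i, α i = 1 ∧ θ = ∑ i, α i • φ (a i) := by
  constructor
  · rw [mem_convexHull_iff_exists_fintype]
    rintro ⟨ι, _, α, z, h0, h1, hz, rfl⟩
    choose a ha using hz
    let e := (Fintype.equivFin ι).symm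
    refine ⟨Fintype.card ι, α ∘ e, a ∘ e, fun i => h0 _, ?_, ?_⟩
    · rw [← h1]
      exact e.sum_comp α
    · rw [← e.sum_comp]
      simp [ha]
  · rintro ⟨n, α, a, h0, h1, rfl⟩
    exact mem_convexHull_of_exists_fintype α _ h0 h1 (fun i => ⟨a i, rfl⟩) rfl

theorem abs_le_of_mem_convexHull {φ : X → Y → ℝ} {C : ℝ} (hC : ∀ a b, |φ a b| ≤ C) {θ : Y → ℝ}
    (hθ : θ ∈ convexHull ℝ (Set.range φ)) (b : Y) : |θ b| ≤ C := by
  have hc : Convex ℝ {θ : Y → ℝ | θ b ∈ Set.Icc (-C) C} :=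
    (convex_Icc (-C) C).linear_preimage (LinearMap.proj (R := ℝ) (φ := fun _ : Y => ℝ) b)
  exact abs_le.2 (convexHull_min (by rintro _ ⟨a, rfl⟩; exact abs_le.1 (hC a b)) hc hθ)

/-- Positive linear functionals on continuous functions on a compact space respect bounded pointwise
limits of sequences. -/
theorem tendsto_of_positive {K : Type*} [TopologicalSpace K] [CompactSpace K] [T2Space K]
    (Λ : C(K, ℝ) →ₗ[ℝ] ℝ) (hΛ : ∀ f, 0 ≤ f → 0 ≤ Λ f) {f : ℕ → C(K, ℝ)} {g : C(K, ℝ)} {C : ℝ}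
    (hC : ∀ n k, |f n k| ≤ C) (hfg : ∀ k, Tendsto (fun n => f n k) atTop (𝓝 (g k))) :
    Tendsto (fun n => Λ (f n)) atTop (𝓝 (Λ g)) := by
  let _ : MeasurableSpace K := borel K
  have _ : BorelSpace K := ⟨rfl⟩
  let e := CompactlySupportedContinuousMap.continuousMapEquiv (α := K) (β := ℝ)
  -- By Riesz–Markov, `Λ` is integration against a finite measure, for which the constant `C` is an
  -- integrable bound.
  let Λ' : CompactlySupportedContinuousMap K ℝ →ₚ[ℝ] ℝ := PositiveLinearMap.mk₀
    { toFun := fun f => Λ (e.symm f)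
      map_add' := fun f g => Λ.map_add (e.symm f) (e.symm g)
      map_smul' := fun c f => Λ.map_smul c (e.symm f) } (fun f hf => hΛ _ hf)
  have key : ∀ f : C(K, ℝ), Λ f = ∫ k, f k ∂(RealRMK.rieszMeasure Λ') := fun f =>
    (RealRMK.integral_rieszMeasure Λ' (e f)).symm
  simp only [key]
  refine MeasureTheory.tendsto_integral_of_dominated_convergence (fun _ => C)
    (fun n => (f n).continuous.aestronglyMeasurable) (MeasureTheory.integrable_const C)
    (fun n => Eventually.of_forall fun k => hC n k) (Eventually.of_forall hfg)

/-- The continuous extension of a bounded function to the space of ultrafilters. -/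
theorem exists_ultrafilter_extension {f : X → ℝ} {C : ℝ} (hf : ∀ a, |f a| ≤ C) :
    ∃ F : C(Ultrafilter X, ℝ), (∀ U, |F U| ≤ C) ∧ (∀ U : Ultrafilter X, Tendsto f U (𝓝 (F U))) ∧
      ∀ a, F (pure a) = f a := by
  have hC : ∀ a, f a ∈ Set.Icc (-C) C := fun a => abs_le.1 (hf a)
  let f' : X → Set.Icc (-C) C := fun a => ⟨f a, hC a⟩
  refine ⟨⟨fun U => ((Ultrafilter.extend f' U : Set.Icc (-C) C) : ℝ),
    continuous_subtype_val.comp (continuous_ultrafilter_extend f')⟩,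
    fun U => abs_le.2 (Ultrafilter.extend f' U).2, fun U => ?_, fun a => ?_⟩
  · have : Tendsto f' U (𝓝 (Ultrafilter.extend f' U)) := ultrafilter_extend_eq_iff.1 rfl
    exact (continuous_subtype_val.tendsto _).comp this
  · exact congrArg Subtype.val (ultrafilter_extend_pure f' a)

/-- The double limit property passes from a set of functions to its convex hull. -/
theorem DoubleLimit.on_convexHull {φ : X → Y → ℝ} (h : DoubleLimit φ) {C : ℝ}
    (hC : ∀ a b, |φ a b| ≤ C) :
    DoubleLimit fun (θ : convexHull ℝ (Set.range φ)) (b : Y) => θ.1 b := by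
  intro θ b f g r s hf hr hg hs
  choose k α x h0 h1 hθ using fun n => mem_convexHull_range_iff.1 (θ n).2
  -- The index set of all points used by some `θ n`. It is countable, so that `[-C, C]^A` is
  -- sequentially compact.
  let A := Σ n, Fin (k n)
  have hθ' : ∀ n b, (θ n).1 b = ∑ i, α n i * φ (x n i) b := fun n b => by
    rw [hθ n]; simp
  obtain ⟨H, hH, u, hu, hlim⟩ := (isCompact_univ_pi fun _ : A =>
    isCompact_Icc (a := -C) (b := C)).tendsto_subseq
    (x := fun m (c : A) => φ (x c.1 c.2) (b m)) (fun m c _ => abs_le.1 (hC _ _))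
  have hlim' : ∀ c : A, Tendsto (fun m => φ (x c.1 c.2) (b (u m))) atTop (𝓝 (H c)) :=
    tendsto_pi_nhds.1 hlim
  obtain ⟨G, hG1, hG2, hG3⟩ := exists_ultrafilter_extension (f := H) (C := C)
    (fun c => abs_le.2 (hH c trivial))
  choose F hF1 hF2 hF3 using fun m => exists_ultrafilter_extension
    (f := fun c : A => φ (x c.1 c.2) (b (u m))) (C := C) (fun c => hC _ _)
  -- Convergence holds on `A` by the choice of `u`; the double limit condition extends it to every
  -- point of the compactification.
  have hFG : ∀ U : Ultrafilter A, Tendsto (fun m => F m U) atTop (𝓝 (G U)) := by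
    intro U
    rw [tendsto_iff_ultrafilter]
    intro W hW
    obtain ⟨t, -, ht⟩ := exists_tendsto_of_bounded W (f := fun m => F m U) (fun m => hF1 m U)
    have := (h.comp (fun c : A => x c.1 c.2) (fun m => b (u m))).exchange (U := U) (V := W)
      (fun m => hF2 m U) (fun c => (hlim' c).mono_left hW) (hG2 U) ht
    rwa [this]
  have hbd : ∀ (Ψ : C(Ultrafilter A, ℝ)) n,
      |∑ i, α n i * Ψ (pure (⟨n, i⟩ : A))| ≤ ‖Ψ‖ := by
    intro Ψ n
    calc |∑ i, α n i * Ψ (pure (⟨n, i⟩ : A))| ≤ ∑ i, |α n i * Ψ (pure (⟨n, i⟩ : A))| :=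
          Finset.abs_sum_le_sum_abs _ _
      _ ≤ ∑ i, α n i * ‖Ψ‖ := by
          refine Finset.sum_le_sum fun i _ => ?_
          rw [abs_mul, abs_of_nonneg (h0 n i)]
          exact mul_le_mul_of_nonneg_left (Ψ.norm_coe_le_norm _) (h0 n i)
      _ = ‖Ψ‖ := by rw [← Finset.sum_mul, h1, one_mul]
  -- Each `θ n` is a probability measure with finite support in `A`; `Λ` is a weak limit of these
  -- measures.
  choose Λ hΛ1 hΛ using fun Ψ => exists_tendsto_of_bounded (hyperfilter ℕ) (hbd Ψ)
  let Λ' : C(Ultrafilter A, ℝ) →ₗ[ℝ] ℝ :=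
    { toFun := Λ
      map_add' := fun Ψ Ψ' => by
        refine tendsto_nhds_unique (hΛ _) (((hΛ Ψ).add (hΛ Ψ')).congr fun n => ?_)
        simp [mul_add, Finset.sum_add_distrib]
      map_smul' := fun c Ψ => by
        refine tendsto_nhds_unique (hΛ _) (((hΛ Ψ).const_mul c).congr fun n => ?_)
        simp [Finset.mul_sum, mul_left_comm] }
  have hpos : ∀ Ψ, 0 ≤ Ψ → 0 ≤ Λ' Ψ := fun Ψ hΨ => ge_of_tendsto' (hΛ Ψ) fun n =>
    Finset.sum_nonneg fun i _ => mul_nonneg (h0 n i) (hΨ _)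
  have hW : (hyperfilter ℕ : Filter ℕ) ≤ atTop := Nat.hyperfilter_le_atTop
  have hlimF := tendsto_of_positive Λ' hpos hF1 hFG
  have e1 : ∀ m, Λ' (F m) = g (u m) := fun m => by
    refine tendsto_nhds_unique (hΛ (F m)) (((hg (u m)).mono_left hW).congr fun n => ?_)
    simp [hθ', hF3]
  have e2 : Λ' G = r := by
    refine tendsto_nhds_unique (hΛ G) ((hr.mono_left hW).congr fun n => ?_)
    refine tendsto_nhds_unique ((hf n).comp hu.tendsto_atTop) ?_
    simp only [hG3]
    refine (tendsto_finsetSum _ fun i _ => (hlim' ⟨n, i⟩).const_mul (α n i)).congr fun m => ?_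
    simp [hθ']
  rw [← e2]
  simp only [e1] at hlimF
  exact tendsto_nhds_unique hlimF (hs.comp hu.tendsto_atTop)

/-- A finite minimax principle. -/
theorem exists_convexHull_forall_ge {g : X → Y → ℝ} {ε : ℝ}
    (h : ∀ θ ∈ convexHull ℝ (Set.range g), ∃ b, ε < θ b) [Nonempty X] (F : Finset X) :
    ∃ ν ∈ convexHull ℝ (Set.range fun b a => g a b), ∀ a ∈ F, ε < ν a := by
  classical
  have hY : Nonempty Y := by
    obtain ⟨a⟩ := ‹Nonempty X›
    obtain ⟨b, -⟩ := h (g a) (subset_convexHull _ _ ⟨a, rfl⟩)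
    exact ⟨b⟩
  by_contra! hcon
  -- If the conclusion fails, the open orthant above `ε` misses the convex hull of the columns, and
  -- a linear functional separates them.
  let O : Set (F → ℝ) := Set.univ.pi fun _ => Set.Ioi ε
  let T : Set (F → ℝ) := convexHull ℝ (Set.range fun (b : Y) (a : F) => g a b)
  have hO : ∀ v, v ∈ O ↔ ∀ a, ε < v a := fun v => by simp [O, Set.mem_pi]
  have hdisj : Disjoint O T := by
    rw [Set.disjoint_left]
    intro v hv hvT
    obtain ⟨n, α, b, h0, h1, rfl⟩ := mem_convexHull_range_iff.1 hvT
    obtain ⟨a, haF, ha⟩ := hcon _ (mem_convexHull_range_iff.2 ⟨n, α, b, h0, h1, rfl⟩)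
    have := (hO _).1 hv ⟨a, haF⟩
    simp only [Finset.sum_apply, Pi.smul_apply] at this ha
    exact absurd this (not_lt.2 ha)
  obtain ⟨f, u, hfO, hfT⟩ := geometric_hahn_banach_open
    (convex_pi fun _ _ => convex_Ioi ε) (isOpen_set_pi Set.finite_univ fun _ _ => isOpen_Ioi)
    (convex_convexHull ℝ _) hdisj
  have hrep : ∀ v : F → ℝ, f v = ∑ a, v a * f (Pi.single a 1) := fun v => by
    conv_lhs => rw [← Finset.univ_sum_single v]
    rw [map_sum]
    refine Finset.sum_congr rfl fun a _ => ?_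
    rw [← smul_eq_mul, ← map_smul, ← Pi.single_smul, smul_eq_mul, mul_one]
  -- `f` is bounded above on the orthant, which is stable under adding nonnegative multiples of the
  -- basis vectors.
  have hneg : ∀ a, f (Pi.single a 1) ≤ 0 := by
    intro a
    by_contra! hp
    let v : F → ℝ := fun _ => ε + 1
    obtain ⟨N, hN⟩ := exists_nat_gt ((u - f v) / f (Pi.single a 1))
    rw [div_lt_iff₀ hp] at hN
    have : f (v + (N : ℝ) • Pi.single a 1) < u := hfO _ ((hO _).2 fun a' => by
      have : 0 ≤ ((N : ℝ) • (Pi.single a 1 : F → ℝ)) a' := by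
        by_cases h : a' = a
        · subst h; simp
        · simp [h]
      simp only [Pi.add_apply, v]
      linarith)
    rw [map_add, map_smul, smul_eq_mul] at this
    linarith
  set σ := ∑ a, - f (Pi.single a 1) with hσ
  -- The value of `f` at the corner of the orthant, reached as a limit from inside.
  have hu : -(ε * σ) ≤ u := by
    have hcl : Tendsto (fun t : ℝ => f (fun _ : F => ε + t)) (𝓝[>] 0) (𝓝 (f fun _ => ε + 0)) := by
      refine Tendsto.mono_left (Continuous.tendsto ?_ 0) nhdsWithin_le_nhds
      exact f.continuous.comp (by fun_prop)
    have := le_of_tendsto hcl (eventually_mem_nhdsWithin.mono fun t ht =>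
      (hfO _ ((hO _).2 fun _ => lt_add_of_pos_right ε ht)).le)
    rw [hrep, ← Finset.mul_sum] at this
    rw [hσ, Finset.sum_neg_distrib]
    linarith
  have hg : ∀ b : Y, ∑ a : F, (- f (Pi.single a 1)) * g a b ≤ ε * σ := fun b => by
    have := hfT (fun a : F => g a b) (subset_convexHull _ _ ⟨b, rfl⟩)
    rw [hrep] at this
    simp only [neg_mul, Finset.sum_neg_distrib]
    simp only [mul_comm (f _)]
    linarith
  have hσ0 : 0 ≤ σ := Finset.sum_nonneg fun a _ => neg_nonneg.2 (hneg a)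
  rcases hσ0.eq_or_lt with h00 | h00
  · have hz : ∀ a, f (Pi.single a 1) = 0 := fun a => by
      have := (Finset.sum_eq_zero_iff_of_nonneg fun a _ => neg_nonneg.2 (hneg a)).1 h00.symm a
        (Finset.mem_univ a)
      linarith
    have hf0 : ∀ v, f v = 0 := fun v => by rw [hrep]; simp [hz]
    obtain ⟨b⟩ := hY
    have h1 := hfT (fun a : F => g a b) (subset_convexHull _ _ ⟨b, rfl⟩)
    have h2 := hfO (fun _ => ε + 1) ((hO _).2 fun _ => by linarith)
    rw [hf0] at h1 h2
    linarith
  -- The normalised coefficients of `-f` combine the rows into a function that is nowhere above `ε`,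
  -- against the hypothesis.
  · obtain ⟨b, hb⟩ := h (∑ a : F, (- f (Pi.single a 1) / σ) • g a) (by
      refine mem_convexHull_of_exists_fintype (fun a : F => - f (Pi.single a 1) / σ) _
        (fun a => div_nonneg (neg_nonneg.2 (hneg a)) hσ0) ?_ (fun a => ⟨a.1, rfl⟩) rfl
      rw [← Finset.sum_div, ← hσ, div_self h00.ne'])
    simp only [Finset.sum_apply, Pi.smul_apply, smul_eq_mul, div_mul_eq_mul_div,
      ← Finset.sum_div] at hb
    rw [lt_div_iff₀ h00] at hb
    linarith [hg b]

/-- A nonnegative bounded function with the double limit property which tends to zero pointwise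
has convex combinations that are uniformly small. -/
theorem DoubleLimit.exists_convexHull_le {g : X → Y → ℝ} (h : DoubleLimit g) {C : ℝ}
    (hC : ∀ a b, |g a b| ≤ C) {U : Filter X} [U.NeBot]
    (hU : ∀ b, Tendsto (fun a => g a b) U (𝓝 0)) {ε : ℝ} (hε : 0 < ε) :
    ∃ θ ∈ convexHull ℝ (Set.range g), ∀ b, θ b ≤ ε := by
  by_contra! hcon
  have hX : Nonempty X := U.nonempty_of_neBot
  let Z := convexHull ℝ (Set.range fun b a => g a b)
  have hC' : ∀ (ν : Z) a, |ν.1 a| ≤ C := fun ν a =>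
    abs_le_of_mem_convexHull (fun b a => hC a b) ν.2 a
  have hZ : DoubleLimit fun (a : X) (ν : Z) => ν.1 a :=
    (h.flip.on_convexHull fun b a => hC a b).flip
  have hUZ : ∀ ν : Z, Tendsto (fun a => ν.1 a) U (𝓝 0) := by
    intro ν
    obtain ⟨n, α, b, -, -, hν⟩ := mem_convexHull_range_iff.1 ν.2
    rw [hν]
    have := tendsto_finsetSum Finset.univ fun i _ => (hU (b i)).const_mul (α i)
    simp only [mul_zero, Finset.sum_const_zero] at this
    exact this.congr fun a => by simp
  classical
  -- New points make the earlier `ν` small, while each new `ν`, given by minimax, exceeds `ε` at all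
  -- earlier points.
  obtain ⟨c, -, hc⟩ := exists_seq_of_forall_finset_exists (α := X × Z × ℕ) (fun _ => True)
    (fun c c' => c.2.2 < c'.2.2 ∧ |c.2.1.1 c'.1| < 1 / ((c'.2.2 : ℝ) + 1) ∧ ε < c'.2.1.1 c.1) (by
    intro S _
    set k := S.sup (fun c => c.2.2) + 1 with hk
    have hpos : (0 : ℝ) < 1 / (k + 1) := Nat.one_div_pos_of_nat
    obtain ⟨a, ha⟩ := ((Filter.eventually_all_finset S).2 fun c _ =>
      Metric.tendsto_nhds.1 (hUZ c.2.1) _ hpos).exists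
    obtain ⟨ν, hν, hν'⟩ := exists_convexHull_forall_ge hcon (S.image fun c => c.1)
    refine ⟨(a, ⟨ν, hν⟩, k), trivial, fun c hcS => ⟨?_, ?_, ?_⟩⟩
    · exact Nat.lt_succ_of_le (Finset.le_sup (f := fun c : X × Z × ℕ => c.2.2) hcS)
    · simpa [Real.dist_eq] using ha c hcS
    · exact hν' _ (Finset.mem_image_of_mem _ hcS))
  have hmono : StrictMono fun n => (c n).2.2 := fun m n hmn => (hc m n hmn).1
  have hlim : Tendsto (fun n => 1 / (((c n).2.2 : ℝ) + 1)) atTop (𝓝 0) :=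
    tendsto_one_div_add_atTop_nhds_zero_nat.comp hmono.tendsto_atTop
  have hW : (hyperfilter ℕ : Filter ℕ) ≤ atTop := Nat.hyperfilter_le_atTop
  choose q hq1 hq using fun n =>
    exists_tendsto_of_bounded (hyperfilter ℕ) (f := fun m => (c m).2.1.1 (c n).1)
      (fun m => hC' _ _)
  obtain ⟨ρ, -, hρ⟩ := exists_tendsto_of_bounded (hyperfilter ℕ) hq1
  have hqε : ∀ n, ε ≤ q n := fun n => ge_of_tendsto (hq n)
    (hW ((eventually_gt_atTop n).mono fun m hm => (hc n m hm).2.2.le))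
  have hp : ∀ m, Tendsto (fun n => (c m).2.1.1 (c n).1) (hyperfilter ℕ) (𝓝 0) := fun m =>
    (squeeze_zero_norm' ((eventually_gt_atTop m).mono fun n hn => (hc m n hn).2.1.le)
      hlim).mono_left hW
  have := (hZ.comp (fun n => (c n).1) (fun m => (c m).2.1)).exchange hp hq hρ tendsto_const_nhds
  have := ge_of_tendsto' hρ hqε
  linarith

/-- For functions with the double limit property, pointwise limits are uniform limits of convex
combinations. -/
theorem DoubleLimit.exists_convexHull_abs_sub_le {φ : X → Y → ℝ} (h : DoubleLimit φ) {C : ℝ}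
    (hC : ∀ a b, |φ a b| ≤ C) {U : Filter X} [U.NeBot] {p : Y → ℝ}
    (hU : ∀ b, Tendsto (fun a => φ a b) U (𝓝 (p b))) {ε : ℝ} (hε : 0 < ε) :
    ∃ θ ∈ convexHull ℝ (Set.range φ), ∀ b, |p b - θ b| ≤ ε := by
  have hp : ∀ b, |p b| ≤ C := fun b => le_of_tendsto' (hU b).abs fun a => hC a b
  have hg := h.abs_sub hC hp
  obtain ⟨θ, hθ, hle⟩ := hg.exists_convexHull_le (C := C + C) (fun a b => by
    rw [abs_abs]; exact (norm_sub_le (φ a b) (p b)).trans (add_le_add (hC a b) (hp b))) (U := U) (fun b => by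
    simpa using ((hU b).sub (tendsto_const_nhds (x := p b))).abs) hε
  -- The weights that make the average of `|φ - p|` small serve for `φ`, by the triangle inequality.
  obtain ⟨n, α, a, h0, h1, rfl⟩ := mem_convexHull_range_iff.1 hθ
  refine ⟨∑ i, α i • φ (a i), mem_convexHull_range_iff.2 ⟨n, α, a, h0, h1, rfl⟩, fun b => ?_⟩
  have e : p b - (∑ i, α i • φ (a i)) b = - ∑ i, α i * (φ (a i) b - p b) := by
    simp [mul_sub, Finset.sum_sub_distrib, ← Finset.sum_mul, h1]
  rw [e, abs_neg]
  refine (Finset.abs_sum_le_sum_abs _ _).trans (le_trans (le_of_eq ?_) (hle b))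
  simp [abs_mul, abs_of_nonneg (h0 _)]

/-- For functions with the double limit property, pointwise limits of convex combinations are
uniform limits of convex combinations. -/
theorem DoubleLimit.exists_abs_sub_le_of_mem_closure {φ : X → Y → ℝ} (h : DoubleLimit φ) {C : ℝ}
    (hC : ∀ a b, |φ a b| ≤ C) {p : Y → ℝ} (hp : p ∈ closure (convexHull ℝ (Set.range φ))) {ε : ℝ}
    (hε : 0 < ε) : ∃ θ ∈ convexHull ℝ (Set.range φ), ∀ b, |p b - θ b| ≤ ε := by
  -- The hull itself becomes the index set, with the trace of the neighbourhoods of `p` as filter;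
  -- the hull of the hull is nothing new.
  have hne := mem_closure_iff_comap_neBot.1 hp
  obtain ⟨θ, hθ, hle⟩ := (h.on_convexHull hC).exists_convexHull_abs_sub_le (C := C)
    (fun θ b => abs_le_of_mem_convexHull hC θ.2 b)
    (U := comap (Subtype.val : convexHull ℝ (Set.range φ) → Y → ℝ) (𝓝 p)) (p := p)
    (fun b => (tendsto_pi_nhds.1 tendsto_comap) b) hε
  refine ⟨θ, ?_, hle⟩
  have : Set.range (fun (θ : convexHull ℝ (Set.range φ)) b => θ.1 b) =
      convexHull ℝ (Set.range φ) := Subtype.range_coe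
  rwa [this, (convex_convexHull ℝ _).convexHull_eq] at hθ

end Convex

variable {L : Language.{l}}

/-! ### Substitution -/

section Substitution

variable {V V' : Type v} {x : V → L.sorts} {x' : V' → L.sorts}

/-- Substitution of terms for the variables of a term. -/
def Term.subst (t : ∀ i, Term L x' (x i)) : ∀ {s : L.sorts}, Term L x s → Term L x' s
  | _, .var i => t i
  | _, .app F u => .app F fun i => (u i).subst t

theorem Term.eval_subst (M : Structure.{l, w} L) (t : ∀ i, Term L x' (x i)) (e : M.Tuple x')
    {s : L.sorts} (u : Term L x s) :
    (u.subst t).eval M e = u.eval M fun i => (t i).eval M e := by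
  induction u with
  | var i => rfl
  | app F u ih => simp only [Term.subst, Term.eval, ih]

/-- The variable added by `addVar`, as a term. -/
def Term.newVar (x : V → L.sorts) (s : L.sorts) : Term L (addVar s x) s :=
  Term.var (x := addVar s x) none

/-- The variables of the original context, as terms in the context enlarged by `addVar`. -/
def Term.oldVar (x : V → L.sorts) (s : L.sorts) (i : V) : Term L (addVar s x) (x i) :=
  Term.var (x := addVar s x) (some i)

/-- The extension of a substitution to one more variable, which is left unchanged. -/
def liftSubst (s : L.sorts) (t : ∀ i, Term L x' (x i)) :
    ∀ o, Term L (addVar s x') (addVar s x o)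
  | none => Term.newVar x' s
  | some i => (t i).subst (Term.oldVar x' s)

theorem eval_liftSubst (M : Structure.{l, w} L) {s : L.sorts} (t : ∀ i, Term L x' (x i))
    (e : M.Tuple x') (a : M.carrier s) :
    (fun o => (liftSubst s t o).eval M (M.cons a e)) = M.cons a fun i => (t i).eval M e := by
  funext o
  cases o with
  | none => rfl
  | some i => exact Term.eval_subst M _ _ _

/-- Substitution of terms for the variables of a formula. -/
def Formula.subst : ∀ {V : Type v} {x : V → L.sorts}, Formula L x → ∀ {V' : Type v}
    {x' : V' → L.sorts}, (∀ i, Term L x' (x i)) → Formula L x'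
  | _, _, .pred P u, _, _, t => .pred P fun i => (u i).subst t
  | _, _, .dist u u', _, _, t => .dist (u.subst t) (u'.subst t)
  | _, _, .conn c φ, _, _, t => .conn c fun i => (φ i).subst t
  | _, _, .sup s φ, _, _, t => .sup s (φ.subst (liftSubst s t))
  | _, _, .inf s φ, _, _, t => .inf s (φ.subst (liftSubst s t))

theorem Formula.eval_subst (M : Structure.{l, w} L) (φ : Formula L x)
    (t : ∀ i, Term L x' (x i)) (e : M.Tuple x') :
    (φ.subst t).eval M e = φ.eval M fun i => (t i).eval M e := by
  induction φ generalizing V' with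
  | pred P u => simp only [Formula.subst, Formula.eval, Term.eval_subst]
  | dist u u' => simp only [Formula.subst, Formula.eval, Term.eval_subst]
  | conn c φ ih => simp only [Formula.subst, Formula.eval, ih]
  | sup s φ ih => simp only [Formula.subst, Formula.eval, ih, eval_liftSubst]
  | inf s φ ih => simp only [Formula.subst, Formula.eval, ih, eval_liftSubst]

theorem Formula.IsAffine.subst {φ : Formula L x} (h : φ.IsAffine) (t : ∀ i, Term L x' (x i)) :
    (φ.subst t).IsAffine := by
  induction φ generalizing V' with
  | pred P u => trivial
  | dist u u' => trivial
  | conn c φ ih => exact ⟨h.1, fun i => ih i (h.2 i) t⟩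
  | sup s φ ih => exact ih h _
  | inf s φ ih => exact ih h _

/-! ### Finiteness of the set of free variables -/

theorem Term.exists_finset_support {s : L.sorts} (u : Term L x s) :
    ∃ S : Finset V, ∀ (M : Structure.{l, w} L) (e e' : M.Tuple x), (∀ i ∈ S, e i = e' i) →
      u.eval M e = u.eval M e' := by
  classical
  induction u with
  | var i => exact ⟨{i}, fun M e e' h => h i (by simp)⟩
  | app F u ih =>
    choose S hS using ih
    refine ⟨Finset.univ.biUnion S, fun M e e' h => ?_⟩
    simp only [Term.eval]
    congr 1
    funext i
    exact hS i M e e' fun j hj => h j (Finset.mem_biUnion.2 ⟨i, Finset.mem_univ _, hj⟩)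

/-- Tuples of variables may be infinite, but quantifiers bind one variable at a time; finite support
makes induction over the relevant variables possible. -/
theorem Formula.exists_finset_support (φ : Formula L x) :
    ∃ S : Finset V, ∀ (M : Structure.{l, w} L) (e e' : M.Tuple x), (∀ i ∈ S, e i = e' i) →
      φ.eval M e = φ.eval M e' := by
  classical
  have hquant : ∀ {V : Type v} {x : V → L.sorts} {s : L.sorts} (φ : Formula L (addVar s x))
      (S : Finset (Option V)), (∀ (M : Structure.{l, w} L) (e e' : M.Tuple (addVar s x)),
        (∀ i ∈ S, e i = e' i) → φ.eval M e = φ.eval M e') →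
      ∀ (M : Structure.{l, w} L) (e e' : M.Tuple x), (∀ i ∈ Finset.eraseNone S, e i = e' i) →
        (fun a => φ.eval M (M.cons a e)) = fun a => φ.eval M (M.cons a e') := by
    intro V x s φ S hS M e e' h
    funext a
    refine hS M _ _ fun o ho => ?_
    cases o with
    | none => rfl
    | some i => exact h i (Finset.mem_eraseNone.2 ho)
  induction φ with
  | pred P u =>
    choose S hS using fun i => (u i).exists_finset_support
    refine ⟨Finset.univ.biUnion S, fun M e e' h => ?_⟩
    simp only [Formula.eval]
    congr 1
    funext i
    exact hS i M e e' fun j hj => h j (Finset.mem_biUnion.2 ⟨i, Finset.mem_univ _, hj⟩)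
  | dist u u' =>
    obtain ⟨S, hS⟩ := u.exists_finset_support
    obtain ⟨S', hS'⟩ := u'.exists_finset_support
    refine ⟨S ∪ S', fun M e e' h => ?_⟩
    simp only [Formula.eval]
    rw [hS M e e' fun i hi => h i (Finset.mem_union_left _ hi),
      hS' M e e' fun i hi => h i (Finset.mem_union_right _ hi)]
  | conn c φ ih =>
    choose S hS using ih
    refine ⟨Finset.univ.biUnion S, fun M e e' h => ?_⟩
    simp only [Formula.eval]
    congr 1
    funext i
    exact hS i M e e' fun j hj => h j (Finset.mem_biUnion.2 ⟨i, Finset.mem_univ _, hj⟩)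
  | sup s φ ih =>
    obtain ⟨S, hS⟩ := ih
    refine ⟨Finset.eraseNone S, fun M e e' h => ?_⟩
    simp only [Formula.eval, hquant φ S hS M e e' h]
  | inf s φ ih =>
    obtain ⟨S, hS⟩ := ih
    refine ⟨Finset.eraseNone S, fun M e e' h => ?_⟩
    simp only [Formula.eval, hquant φ S hS M e e' h]

/-! ### Quantification over a variable of the context -/

open Classical in
/-- The substitution which replaces the variable `i` by a new variable. -/
noncomputable def renewVar (i : V) : ∀ j, Term L (addVar (x i) x) (x j) := fun j =>
  if h : i = j then h ▸ Term.newVar x (x i) else Term.oldVar x (x i) j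

open Classical in
theorem eval_renewVar (M : Structure.{l, w} L) (i : V) (e : M.Tuple x) (a : M.carrier (x i)) :
    (fun j => (renewVar i j).eval M (M.cons a e)) = Function.update e i a := by
  funext j
  by_cases h : i = j
  · subst h
    rw [renewVar, dif_pos rfl, Function.update_self]
    rfl
  · rw [renewVar, dif_neg h, Function.update_of_ne (Ne.symm h)]
    rfl

/-- The infimum of `φ` over the variable `i` of its context. -/
noncomputable def Formula.infVar (i : V) (φ : Formula L x) : Formula L x :=
  .inf (x i) (φ.subst (renewVar i))

open Classical in
theorem Formula.eval_infVar (M : Structure.{l, w} L) (i : V) (φ : Formula L x) (e : M.Tuple x) :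
    (φ.infVar i).eval M e = ⨅ a, φ.eval M (Function.update e i a) := by
  simp only [Formula.infVar, Formula.eval, Formula.eval_subst, eval_renewVar]

theorem Formula.IsAffine.infVar {φ : Formula L x} (h : φ.IsAffine) (i : V) :
    (φ.infVar i).IsAffine :=
  Formula.IsAffine.subst h (renewVar i)

/-- If the values of the formulas in a class closed under infima agree in `M` and its extension `N`,
then small values in `N` are approximated in `M` after a change of finitely many coordinates. -/
theorem exists_eval_le_add {K : ∀ {V : Type v} {x : V → L.sorts}, Formula L x → Prop}
    (hK : ∀ (i : V) (φ : Formula L x), K φ → K (φ.infVar i)) {M N : Structure.{l, w} L}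
    {j : ∀ s, M.carrier s → N.carrier s}
    (hj : ∀ (φ : Formula L x), K φ → ∀ a, φ.eval N (fun i => j _ (a i)) = φ.eval M a)
    (S : Finset V) (φ : Formula L x) (hφ : K φ) (c : M.Tuple x) (c' : N.Tuple x)
    (hc : ∀ i ∉ S, c' i = j _ (c i)) {ε : ℝ} (hε : 0 < ε) :
    ∃ d : M.Tuple x, (∀ i ∉ S, d i = c i) ∧ φ.eval M d ≤ φ.eval N c' + ε := by
  classical
  induction S using Finset.induction_on generalizing φ c c' ε with
  | empty =>
    refine ⟨c, fun _ _ => rfl, ?_⟩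
    have : c' = fun i => j _ (c i) := funext fun i => hc i (by simp)
    rw [this, hj φ hφ]
    linarith
  | insert i S hi ih =>
    -- Once `i` is quantified away its coordinate is irrelevant, so it is reset to a value coming
    -- from `M`. Half of `ε` is kept for choosing a near-minimiser at `i`.
    obtain ⟨d, hd, hle⟩ := ih (φ.infVar i) (hK i φ hφ) c (Function.update c' i (j _ (c i)))
      (fun k hk => by
        by_cases h : k = i
        · subst h; simp
        · rw [Function.update_of_ne h]
          exact hc k (by simp [h, hk])) (half_pos hε)
    rw [Formula.eval_infVar, Formula.eval_infVar] at hle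
    obtain ⟨C, hC⟩ := φ.exists_bound
    have h1 : ⨅ a, φ.eval N (Function.update (Function.update c' i (j _ (c i))) i a) ≤
        φ.eval N c' := by
      refine (ciInf_le ⟨-C, ?_⟩ (c' i)).trans (le_of_eq ?_)
      · rintro _ ⟨a, rfl⟩
        exact (abs_le.1 (hC N _)).1
      · simp
    obtain ⟨a, ha⟩ := exists_lt_of_ciInf_lt (lt_add_of_pos_right
      (⨅ a, φ.eval M (Function.update d i a)) (half_pos hε))
    refine ⟨Function.update d i a, fun k hk => ?_, by linarith⟩
    have hk' : k ≠ i := fun h => hk (by simp [h])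
    rw [Function.update_of_ne hk']
    exact hd k fun h => hk (by simp [h])

end Substitution

/-! ### Types are approximated by points of the structure -/

section Types

variable {V W : Type v} {x : V → L.sorts} {y : W → L.sorts}

/-- The formula `u(φ(x,y₁),…,φ(x,yₙ))`, in the variables `x, y₁, …, yₙ`. -/
def Formula.connInstances (φ : Formula L (Sum.elim x y)) {n : ℕ} (u : C(Fin n → ℝ, ℝ)) :
    Formula L (Sum.elim x fun c : Fin n × W => y c.2) :=
  .conn u fun k => φ.subst fun
    | .inl i => Term.var (x := Sum.elim x fun c : Fin n × W => y c.2) (.inl i)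
    | .inr i => Term.var (x := Sum.elim x fun c : Fin n × W => y c.2) (.inr (k, i))

theorem Formula.eval_connInstances (φ : Formula L (Sum.elim x y)) {n : ℕ} (u : C(Fin n → ℝ, ℝ))
    (M : Structure.{l, w} L) (e : M.Tuple (Sum.elim x fun c : Fin n × W => y c.2)) :
    (φ.connInstances u).eval M e =
      u fun k => φ.interp M (fun i => e (.inl i)) fun i => e (.inr (k, i)) := by
  simp only [Formula.connInstances, Formula.eval, Formula.eval_subst, Formula.interp]
  congr 1
  funext k
  congr 1
  funext o
  cases o <;> rfl

/-- `A` is a switch: `False` allows all formulas and connectives (elementary extensions), `True`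
restricts to affine ones (affine extensions). -/
theorem exists_conn_le_add (A : Prop) (φ : Formula L (Sum.elim x y)) (hφ : A → φ.IsAffine) {n : ℕ}
    (u : C(Fin n → ℝ, ℝ)) (hu : A → ∃ (c : ℝ) (α : Fin n → ℝ), ∀ t, u t = c + ∑ i, α i * t i)
    {M N : Structure.{l, w} L} {j : ∀ s, M.carrier s → N.carrier s}
    (hj : ∀ {Z : Type v} (z : Z → L.sorts) (θ : Formula L z), (A → θ.IsAffine) →
      ∀ a : M.Tuple z, θ.eval N (fun i => j _ (a i)) = θ.eval M a)
    (a' : N.Tuple x) (b : Fin n → M.Tuple y) {ε : ℝ} (hε : 0 < ε) :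
    ∃ a : M.Tuple x, u (fun k => φ.interp M a (b k)) ≤
      u (fun k => φ.interp N a' fun i => j _ (b k i)) + ε := by
  classical
  obtain ⟨S, hS⟩ := (φ.connInstances u).exists_finset_support
  let a₀ : M.Tuple x := fun i => Classical.arbitrary _
  let c : M.Tuple (Sum.elim x fun c : Fin n × W => y c.2) := M.append a₀ fun p => b p.1 p.2
  let c₁ : N.Tuple (Sum.elim x fun c : Fin n × W => y c.2) :=
    N.append a' fun p => j _ (b p.1 p.2)
  let T : Finset (V ⊕ (Fin n × W)) := S.filter fun o => o.isLeft = true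
  -- The tuple of interest, altered outside the support so that only finitely many `x`-coordinates
  -- lie outside the image of `M`.
  let c' : N.Tuple (Sum.elim x fun c : Fin n × W => y c.2) := fun o =>
    if o ∈ T then c₁ o else j _ (c o)
  have hcc : ∀ o ∈ S, c' o = c₁ o := by
    intro o ho
    simp only [c']
    split_ifs with h
    · rfl
    · cases o with
      | inl i => exact absurd (Finset.mem_filter (p := fun o => o.isLeft = true) |>.2 ⟨ho, rfl⟩) h
      | inr i => rfl
  obtain ⟨d, hd, hle⟩ := exists_eval_le_add (K := fun θ => A → θ.IsAffine)
    (fun i θ hθ h => (hθ h).infVar i) (fun θ => hj _ θ) T (φ.connInstances u)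
    (fun h => ⟨hu h, fun k => (hφ h).subst _⟩) c c' (fun o ho => if_neg ho) hε
  refine ⟨fun i => d (.inl i), ?_⟩
  rw [hS N c' c₁ hcc, Formula.eval_connInstances, Formula.eval_connInstances] at hle
  have hd' : ∀ k i, d (.inr (k, i)) = b k i := fun k i =>
    hd (.inr (k, i)) fun h => by simpa [T] using (Finset.mem_filter.1 h).2
  simp only [hd'] at hle
  exact hle

/-- The connective `∑ |t k - p(b k)|` vanishes at a realisation of `p`, hence takes arbitrarily
small values on `M`. -/
theorem mem_closure_of_mem_contTypes (φ : Formula L (Sum.elim x y)) {M : Structure.{l, w} L}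
    {p : M.Tuple y → ℝ} (hp : p ∈ contTypes φ.interp M) :
    p ∈ closure (Set.range (φ.interp M)) := by
  obtain ⟨N, j, hj, a', ha'⟩ := hp
  rw [mem_closure_iff_nhds]
  intro O hO
  rw [nhds_pi, Filter.mem_pi] at hO
  obtain ⟨I, hI, t, ht, hsub⟩ := hO
  choose ε hε hball using fun b => Metric.mem_nhds_iff.1 (ht b)
  lift I to Finset (M.Tuple y) using hI
  let e := I.equivFin.symm
  have hδ : ∃ δ > 0, ∀ b ∈ I, δ ≤ ε b := by
    rcases I.eq_empty_or_nonempty with rfl | hne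
    · exact ⟨1, one_pos, by simp⟩
    · exact ⟨I.inf' hne ε, (Finset.lt_inf'_iff _).2 fun b _ => hε b,
        fun b hb => Finset.inf'_le _ hb⟩
  obtain ⟨δ, hδ, hδε⟩ := hδ
  obtain ⟨a, ha⟩ := exists_conn_le_add False φ False.elim
    ⟨fun t => ∑ k, |t k - p (e k)|, by fun_prop⟩ False.elim
    (fun z θ _ => hj z θ) a' (fun k => (e k : M.Tuple y)) (half_pos hδ)
  refine ⟨φ.interp M a, hsub fun b hb => hball b ?_, ⟨a, rfl⟩⟩
  simp only [← ha', ContinuousMap.coe_mk, sub_self, abs_zero, Finset.sum_const_zero, zero_add] at ha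
  have := (Finset.single_le_sum (f := fun k => |φ.interp M a (e k) - p (e k)|)
    (fun _ _ => abs_nonneg _) (Finset.mem_univ (I.equivFin ⟨b, hb⟩))).trans ha
  simp only [e, Equiv.symm_apply_apply] at this
  rw [Metric.mem_ball, Real.dist_eq]
  linarith [hδε b hb]

/-- A continuous linear functional on a product depends on finitely many coordinates. -/
theorem exists_finset_sum_of_continuous {Y : Type*} (f : (Y → ℝ) →L[ℝ] ℝ) :
    ∃ (I : Finset Y) (α : Y → ℝ), ∀ v, f v = ∑ b ∈ I, α b * v b := by
  classical
  have h1 : f ⁻¹' Metric.ball 0 1 ∈ 𝓝 (0 : Y → ℝ) := by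
    refine f.continuous.continuousAt ?_
    rw [map_zero]
    exact Metric.ball_mem_nhds 0 one_pos
  rw [nhds_pi, Filter.mem_pi] at h1
  obtain ⟨I, hI, t, ht, hsub⟩ := h1
  lift I to Finset Y using hI
  have hzero : ∀ v : Y → ℝ, (∀ b ∈ I, v b = 0) → f v = 0 := by
    intro v hv
    by_contra hne
    -- The neighbourhood does not restrict `v` off `I`, so `v` can be rescaled to have value `2`
    -- under `f`, outside the ball.
    have : ((2 / f v) • v) ∈ f ⁻¹' Metric.ball 0 1 := hsub fun b hb => by
      rw [Pi.smul_apply, hv b hb, smul_zero]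
      exact mem_of_mem_nhds (ht b)
    rw [Set.mem_preimage, map_smul, smul_eq_mul, div_mul_cancel₀ _ hne] at this
    norm_num at this
  refine ⟨I, fun b => f (Pi.single b 1), fun v => ?_⟩
  have := hzero (v - ∑ b ∈ I, v b • Pi.single b 1) fun b hb => by
    simp [Finset.sum_apply, Pi.single_apply, hb]
  rw [map_sub, map_sum, sub_eq_zero] at this
  simp only [this, map_smul, smul_eq_mul, mul_comm]

/-- A functional separating `p` from the hull involves finitely many instances, so it is an affine
connective; its value at `p` is then nearly bounded below by a value on `M`, which contradicts the
separation. -/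
theorem mem_closure_convexHull_of_mem_affTypes (φ : Formula L (Sum.elim x y)) (hφ : φ.IsAffine)
    {M : Structure.{l, w} L} {p : M.Tuple y → ℝ} (hp : p ∈ affTypes φ.interp M) :
    p ∈ closure (convexHull ℝ (Set.range (φ.interp M))) := by
  obtain ⟨N, j, hj, a', ha'⟩ := hp
  by_contra hcon
  obtain ⟨f, u, hfp, hf⟩ := geometric_hahn_banach_point_closed
    (convex_convexHull ℝ (Set.range (φ.interp M))).closure isClosed_closure hcon
  obtain ⟨I, α, hα⟩ := exists_finset_sum_of_continuous f
  let e := I.equivFin.symm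
  have hrep : ∀ v, f v = ∑ k, α (e k) * v (e k) := fun v => by
    rw [hα, ← Finset.sum_coe_sort, ← e.sum_comp]
  obtain ⟨a, ha⟩ := exists_conn_le_add True φ (fun _ => hφ)
    ⟨fun t => ∑ k, α (e k) * t k, by fun_prop⟩ (fun _ => ⟨0, fun k => α (e k), by simp⟩)
    (fun z θ h => hj z θ (h trivial)) a' (fun k => (e k : M.Tuple y)) (sub_pos.2 hfp)
  simp only [← ha', ContinuousMap.coe_mk, ← hrep] at ha
  have := hf (φ.interp M a) (subset_closure (subset_convexHull _ _ ⟨a, rfl⟩))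
  linarith

/-- The formula `φ^op`. -/
def Formula.op (φ : Formula L (Sum.elim x y)) : Formula L (Sum.elim y x) :=
  φ.subst fun
    | .inl i => Term.var (x := Sum.elim y x) (.inr i)
    | .inr i => Term.var (x := Sum.elim y x) (.inl i)

theorem Formula.interp_op (φ : Formula L (Sum.elim x y)) :
    (φ.op.interp : Interp.{l, v, w} y x) = φ.interp.op := by
  funext N b a
  simp only [Formula.op, Formula.interp, Interp.op, Formula.eval_subst]
  congr 1
  funext o
  cases o <;> rfl

end Types

/-! ### The ultrapower of a structure along a nonprincipal ultrafilter on `ℕ` -/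

section Ultrapower

variable (M : Structure.{l, w} L)

/-- Sequences in a sort of `M`, with the limit of the distances as pseudometric. -/
def Structure.Seq (s : L.sorts) : Type w := ℕ → M.carrier s

variable {M}

theorem Structure.exists_tendsto_dist {s : L.sorts} (a b : M.Seq s) :
    ∃ t, Tendsto (fun n => dist (a n) (b n)) (hyperfilter ℕ) (𝓝 t) := by
  obtain ⟨t, -, ht⟩ := exists_tendsto_of_bounded (hyperfilter ℕ)
    (f := fun n => dist (a n) (b n)) (C := L.diam s)
    fun n => by rw [abs_of_nonneg dist_nonneg]; exact M.dist_le s _ _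
  exact ⟨t, ht⟩

noncomputable instance Structure.Seq.instPseudoMetricSpace (s : L.sorts) :
    PseudoMetricSpace (M.Seq s) where
  dist a b := (Structure.exists_tendsto_dist a b).choose
  dist_self a := tendsto_nhds_unique (Structure.exists_tendsto_dist a a).choose_spec
    (by simp)
  dist_comm a b := tendsto_nhds_unique (Structure.exists_tendsto_dist a b).choose_spec
    (by simpa only [dist_comm] using (Structure.exists_tendsto_dist b a).choose_spec)
  dist_triangle a b c := le_of_tendsto_of_tendsto'
    (Structure.exists_tendsto_dist a c).choose_spec
    ((Structure.exists_tendsto_dist a b).choose_spec.add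
      (Structure.exists_tendsto_dist b c).choose_spec) fun n => dist_triangle _ _ _

theorem Structure.Seq.tendsto_dist {s : L.sorts} (a b : M.Seq s) :
    Tendsto (fun n => dist (a n) (b n)) (hyperfilter ℕ) (𝓝 (dist a b)) :=
  (Structure.exists_tendsto_dist a b).choose_spec

theorem Structure.Seq.tendsto_nndist {s : L.sorts} (a b : M.Seq s) :
    Tendsto (fun n => nndist (a n) (b n)) (hyperfilter ℕ) (𝓝 (nndist a b)) :=
  NNReal.tendsto_coe.1 (Structure.Seq.tendsto_dist a b)

instance Structure.Seq.instCompleteSpace (s : L.sorts) : CompleteSpace (M.Seq s) := by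
  classical
  refine Metric.complete_of_convergent_controlled_sequences (fun n => (1 / 2 : ℝ) ^ n)
    (fun n => by positivity) fun u hu => ?_
  let P : ℕ → ℕ → Prop := fun i n => n ≤ i ∧ ∀ k ≤ n, ∀ m ≤ n, k ≤ m →
    dist (u k i) (u m i) < (1 / 2 : ℝ) ^ k
  have hP : ∀ n, ∀ᶠ i in hyperfilter ℕ, P i n := by
    intro n
    have hn : ∀ᶠ i in hyperfilter ℕ, n ≤ i := Nat.hyperfilter_le_atTop (eventually_ge_atTop n)
    refine hn.and ?_
    have h : ∀ k ∈ Finset.range (n + 1), ∀ m ∈ Finset.range (n + 1), ∀ᶠ i in hyperfilter ℕ,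
        k ≤ m → dist (u k i) (u m i) < (1 / 2 : ℝ) ^ k := by
      intro k _ m _
      by_cases hkm : k ≤ m
      · filter_upwards [(Structure.Seq.tendsto_dist (u k) (u m)).eventually_lt_const
          (hu k k m le_rfl hkm)] with i hi _ using hi
      · exact Eventually.of_forall fun i h => absurd h hkm
    have h' := (eventually_all_finset _).2 fun k hk => (eventually_all_finset _).2 (h k hk)
    filter_upwards [h'] with i hi k hk m hm
    exact hi k (Finset.mem_range_succ_iff.2 hk) m (Finset.mem_range_succ_iff.2 hm)
  -- Diagonal limit: coordinate `i` follows `u` as far as the Cauchy estimates hold there. For each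
  -- `n` this is at least `n` for almost all `i`, because the ultrafilter is nonprincipal.
  let g : M.Seq s := fun i => u (Nat.findGreatest (P i) i) i
  have hg : ∀ n, dist (u n) g ≤ (1 / 2 : ℝ) ^ n := by
    intro n
    refine le_of_tendsto (Structure.Seq.tendsto_dist (u n) g) ?_
    filter_upwards [hP n] with i hi
    have hn := Nat.le_findGreatest hi.1 hi
    exact ((Nat.findGreatest_spec hi.1 hi).2 n hn _ le_rfl hn).le
  refine ⟨g, tendsto_iff_dist_tendsto_zero.2 (squeeze_zero (fun _ => dist_nonneg) hg ?_)⟩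
  exact tendsto_pow_atTop_nhds_zero_of_lt_one (by norm_num) (by norm_num)

theorem Structure.exists_tendsto_predMap (P : L.Pred) (a : ∀ i, M.Seq (L.predDom P i)) :
    ∃ t ∈ Set.Icc (L.predLo P) (L.predHi P),
      Tendsto (fun n => M.predMap P fun i => a i n) (hyperfilter ℕ) (𝓝 t) := by
  obtain ⟨t, -, ht⟩ := exists_tendsto_of_bounded (hyperfilter ℕ)
    (f := fun n => M.predMap P fun i => a i n)
    (fun n => abs_le_max_abs_abs (M.predMap_mem P fun i => a i n).1 (M.predMap_mem P _).2)
  exact ⟨t, isClosed_Icc.mem_of_tendsto ht (Eventually.of_forall fun n => M.predMap_mem P _), ht⟩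

theorem Structure.Seq.nndist_funMap_le (F : L.Fun) (a b : ∀ i, M.Seq (L.funDom F i)) :
    nndist (α := M.Seq (L.funCod F)) (fun n => M.funMap F fun i => a i n)
      (fun n => M.funMap F fun i => b i n) ≤
      (L.funModulus F).toFun fun i => nndist (a i) (b i) :=
  le_of_tendsto_of_tendsto' (Structure.Seq.tendsto_nndist _ _)
    (((L.funModulus F).continuous_toFun.tendsto _).comp
      (tendsto_pi_nhds.2 fun i => Structure.Seq.tendsto_nndist (a i) (b i)))
    fun _ => M.funMap_modulus F _ _

theorem Structure.Seq.nndist_predMap_le (P : L.Pred) (a b : ∀ i, M.Seq (L.predDom P i)) {r s : ℝ}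
    (hr : Tendsto (fun n => M.predMap P fun i => a i n) (hyperfilter ℕ) (𝓝 r))
    (hs : Tendsto (fun n => M.predMap P fun i => b i n) (hyperfilter ℕ) (𝓝 s)) :
    nndist r s ≤ (L.predModulus P).toFun fun i => nndist (a i) (b i) :=
  le_of_tendsto_of_tendsto' (hr.nndist hs)
    (((L.predModulus P).continuous_toFun.tendsto _).comp
      (tendsto_pi_nhds.2 fun i => Structure.Seq.tendsto_nndist (a i) (b i)))
    fun _ => M.predMap_modulus P _ _

/-- A sequence which represents a point of the ultrapower. -/
noncomputable def Structure.Seq.rep {s : L.sorts} (a : SeparationQuotient (M.Seq s)) : M.Seq s :=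
  (SeparationQuotient.surjective_mk a).choose

theorem Structure.Seq.mk_rep {s : L.sorts} (a : SeparationQuotient (M.Seq s)) :
    SeparationQuotient.mk (Structure.Seq.rep a) = a :=
  (SeparationQuotient.surjective_mk a).choose_spec

theorem Structure.Seq.nndist_rep {s : L.sorts} (a b : SeparationQuotient (M.Seq s)) :
    nndist (Structure.Seq.rep a) (Structure.Seq.rep b) = nndist a b := by
  conv_rhs => rw [← Structure.Seq.mk_rep a, ← Structure.Seq.mk_rep b]
  rfl

theorem Structure.Seq.nndist_rep_mk {s : L.sorts} (a : M.Seq s) :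
    nndist (Structure.Seq.rep (SeparationQuotient.mk a)) a = 0 := by
  have : nndist (SeparationQuotient.mk (Structure.Seq.rep (SeparationQuotient.mk a)))
      (SeparationQuotient.mk a) = 0 := by rw [Structure.Seq.mk_rep, nndist_self]
  exact this

variable (M) in
/-- The ultrapower of `M` along a nonprincipal ultrafilter on `ℕ`. -/
noncomputable def Structure.ultrapower : Structure.{l, w} L where
  carrier s := SeparationQuotient (M.Seq s)
  metric s := inferInstance
  complete s := inferInstance
  nonempty s := ⟨SeparationQuotient.mk (fun _ => Classical.arbitrary (M.carrier s) : M.Seq s)⟩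
  dist_le s a b := by
    rw [← Structure.Seq.mk_rep a, ← Structure.Seq.mk_rep b, SeparationQuotient.dist_mk]
    exact le_of_tendsto' (Structure.Seq.tendsto_dist _ _) fun n => M.dist_le s _ _
  funMap F a := SeparationQuotient.mk
    (fun n => M.funMap F fun i => Structure.Seq.rep (a i) n : M.Seq (L.funCod F))
  funMap_modulus F a b := by
    have := Structure.Seq.nndist_funMap_le F (fun i => Structure.Seq.rep (a i))
      (fun i => Structure.Seq.rep (b i))
    simp only [Structure.Seq.nndist_rep] at this
    exact this
  predMap P a := (Structure.exists_tendsto_predMap P fun i => Structure.Seq.rep (a i)).choose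
  predMap_modulus P a b := by
    have := Structure.Seq.nndist_predMap_le P _ _
      (Structure.exists_tendsto_predMap P fun i => Structure.Seq.rep (a i)).choose_spec.2
      (Structure.exists_tendsto_predMap P fun i => Structure.Seq.rep (b i)).choose_spec.2
    simp only [Structure.Seq.nndist_rep] at this
    exact this
  predMap_mem P a :=
    (Structure.exists_tendsto_predMap P fun i => Structure.Seq.rep (a i)).choose_spec.1

/-- The point of the ultrapower represented by a sequence. -/
noncomputable def Structure.Seq.toUltrapower {s : L.sorts} (a : M.Seq s) : M.ultrapower.carrier s :=
  SeparationQuotient.mk a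

theorem Structure.Seq.exists_toUltrapower_eq {s : L.sorts} (a : M.ultrapower.carrier s) :
    ∃ b : M.Seq s, b.toUltrapower = a :=
  SeparationQuotient.surjective_mk a

/-- The choice of representatives is harmless, since the modulus vanishes at zero. -/
theorem Structure.ultrapower_funMap (F : L.Fun) (a : ∀ i, M.Seq (L.funDom F i)) :
    M.ultrapower.funMap F (fun i => (a i).toUltrapower) =
      Structure.Seq.toUltrapower (M := M) (s := L.funCod F) fun n => M.funMap F fun i => a i n := by
  refine eq_of_dist_eq_zero (le_antisymm ?_ dist_nonneg)
  have := Structure.Seq.nndist_funMap_le F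
    (fun i => Structure.Seq.rep (SeparationQuotient.mk (a i))) a
  simp only [Structure.Seq.nndist_rep_mk] at this
  rw [show (fun _ => 0 : Fin (L.funArity F) → ℝ≥0) = 0 from rfl, (L.funModulus F).map_zero] at this
  exact NNReal.coe_le_coe.2 this

theorem Structure.ultrapower_predMap (P : L.Pred) (a : ∀ i, M.Seq (L.predDom P i)) :
    Tendsto (fun n => M.predMap P fun i => a i n) (hyperfilter ℕ)
      (𝓝 (M.ultrapower.predMap P fun i => (a i).toUltrapower)) := by
  obtain ⟨t, -, ht⟩ := Structure.exists_tendsto_predMap P a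
  have := Structure.Seq.nndist_predMap_le P _ _ (Structure.exists_tendsto_predMap P fun i =>
    Structure.Seq.rep (SeparationQuotient.mk (a i))).choose_spec.2 ht
  simp only [Structure.Seq.nndist_rep_mk] at this
  rw [show (fun _ => 0 : Fin (L.predArity P) → ℝ≥0) = 0 from rfl, (L.predModulus P).map_zero,
    nonpos_iff_eq_zero, nndist_eq_zero] at this
  rw [← this] at ht
  exact ht

variable {V : Type v} {x : V → L.sorts}

theorem Term.eval_ultrapower (e : ∀ i, M.Seq (x i)) {s : L.sorts} (u : Term L x s) :
    u.eval M.ultrapower (fun i => (e i).toUltrapower) =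
      Structure.Seq.toUltrapower (M := M) (s := s) fun n => u.eval M fun i => e i n := by
  induction u with
  | var i => rfl
  | app F t ih => simp only [Term.eval, ih]; exact Structure.ultrapower_funMap F _

/-- The enlargement of a tuple of sequences by a further sequence. -/
def Structure.Seq.cons {s : L.sorts} (a : M.Seq s) (e : ∀ i, M.Seq (x i)) :
    ∀ o, M.Seq (addVar s x o)
  | none => a
  | some i => e i

theorem Structure.Seq.cons_apply {s : L.sorts} (a : M.Seq s) (e : ∀ i, M.Seq (x i)) (n : ℕ) :
    (fun o => Structure.Seq.cons a e o n) = M.cons (a n) fun i => e i n := by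
  funext o
  cases o <;> rfl

theorem Structure.Seq.toUltrapower_cons {s : L.sorts} (a : M.Seq s) (e : ∀ i, M.Seq (x i)) :
    (fun o => (Structure.Seq.cons a e o).toUltrapower) =
      M.ultrapower.cons a.toUltrapower fun i => (e i).toUltrapower := by
  funext o
  cases o <;> rfl

/-- **Łoś's theorem** for continuous logic. -/
theorem Formula.tendsto_eval_ultrapower (φ : Formula L x) (e : ∀ i, M.Seq (x i)) :
    Tendsto (fun n => φ.eval M fun i => e i n) (hyperfilter ℕ)
      (𝓝 (φ.eval M.ultrapower fun i => (e i).toUltrapower)) := by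
  have hone : Tendsto (fun n : ℕ => 1 / ((n : ℝ) + 1)) (hyperfilter ℕ) (𝓝 0) :=
    tendsto_one_div_add_atTop_nhds_zero_nat.mono_left Nat.hyperfilter_le_atTop
  induction φ with
  | pred P u =>
    simp only [Formula.eval, Term.eval_ultrapower]
    exact Structure.ultrapower_predMap P _
  | dist u u' =>
    simp only [Formula.eval, Term.eval_ultrapower]
    exact Structure.Seq.tendsto_dist _ _
  | conn c φ ih =>
    exact (c.continuous.tendsto _).comp (tendsto_pi_nhds.2 fun i => ih i e)
  | sup s φ ih =>
    obtain ⟨C, hC⟩ := (Formula.sup s φ).exists_bound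
    obtain ⟨D, hD⟩ := φ.exists_bound
    have hbdd : ∀ (N : Structure.{l, w} L) e,
        BddAbove (Set.range fun a => φ.eval N (N.cons a e)) := fun N e =>
      ⟨D, by rintro _ ⟨a, rfl⟩; exact (abs_le.1 (hD N _)).2⟩
    obtain ⟨t, -, ht⟩ := exists_tendsto_of_bounded (hyperfilter ℕ) fun n => hC M fun i => e i n
    have key : ∀ a : M.Seq s, Tendsto (fun n => φ.eval M (M.cons (a n) fun i => e i n))
        (hyperfilter ℕ)
        (𝓝 (φ.eval M.ultrapower (M.ultrapower.cons a.toUltrapower fun i => (e i).toUltrapower))) := by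
      intro a
      have := ih (Structure.Seq.cons a e)
      simpa only [Structure.Seq.cons_apply, Structure.Seq.toUltrapower_cons] using this
    simp only [Formula.eval] at ht ⊢
    convert ht using 2
    apply le_antisymm
    · refine ciSup_le fun a => ?_
      obtain ⟨a, rfl⟩ := Structure.Seq.exists_toUltrapower_eq a
      exact le_of_tendsto_of_tendsto' (key a) ht fun n => le_ciSup (hbdd M _) (a n)
    -- Coordinatewise near-maximisers, with error `1 / (n + 1)`, form a point of the ultrapower that
    -- attains the limit.
    · choose a ha using fun n : ℕ => exists_lt_of_lt_ciSup (sub_lt_self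
        (⨆ a, φ.eval M (M.cons a fun i => e i n)) (Nat.one_div_pos_of_nat (α := ℝ) (n := n)))
      refine le_trans ?_ (le_ciSup (hbdd M.ultrapower _) (Structure.Seq.toUltrapower a))
      refine le_of_tendsto_of_tendsto' ?_ (key a) fun n => (ha n).le
      simpa using ht.sub hone
  | inf s φ ih =>
    obtain ⟨C, hC⟩ := (Formula.inf s φ).exists_bound
    obtain ⟨D, hD⟩ := φ.exists_bound
    have hbdd : ∀ (N : Structure.{l, w} L) e,
        BddBelow (Set.range fun a => φ.eval N (N.cons a e)) := fun N e =>
      ⟨-D, by rintro _ ⟨a, rfl⟩; exact (abs_le.1 (hD N _)).1⟩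
    obtain ⟨t, -, ht⟩ := exists_tendsto_of_bounded (hyperfilter ℕ) fun n => hC M fun i => e i n
    have key : ∀ a : M.Seq s, Tendsto (fun n => φ.eval M (M.cons (a n) fun i => e i n))
        (hyperfilter ℕ)
        (𝓝 (φ.eval M.ultrapower (M.ultrapower.cons a.toUltrapower fun i => (e i).toUltrapower))) := by
      intro a
      have := ih (Structure.Seq.cons a e)
      simpa only [Structure.Seq.cons_apply, Structure.Seq.toUltrapower_cons] using this
    simp only [Formula.eval] at ht ⊢
    convert ht using 2
    apply le_antisymm
    · choose a ha using fun n : ℕ => exists_lt_of_ciInf_lt (lt_add_of_pos_right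
        (⨅ a, φ.eval M (M.cons a fun i => e i n)) (Nat.one_div_pos_of_nat (α := ℝ) (n := n)))
      refine (ciInf_le (hbdd M.ultrapower _) (Structure.Seq.toUltrapower a)).trans ?_
      refine le_of_tendsto_of_tendsto' (key a) ?_ fun n => (ha n).le
      simpa using ht.add hone
    · refine le_ciInf fun a => ?_
      obtain ⟨a, rfl⟩ := Structure.Seq.exists_toUltrapower_eq a
      exact le_of_tendsto_of_tendsto' ht (key a) fun n => ciInf_le (hbdd M _) (a n)

variable (M) in
/-- The diagonal embedding of `M` into its ultrapower. -/
noncomputable def Structure.diagonal (s : L.sorts) (a : M.carrier s) : M.ultrapower.carrier s :=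
  Structure.Seq.toUltrapower (M := M) fun _ => a

theorem Structure.isElementary_diagonal :
    IsElementary.{l, v, w} M M.ultrapower M.diagonal := fun _ θ a =>
  tendsto_nhds_unique (θ.tendsto_eval_ultrapower fun i _ => a i) tendsto_const_nhds

/-- Limits of the types of points of `M` along `hyperfilter ℕ` are continuous types. -/
theorem mem_contTypes_of_tendsto {W : Type v} {y : W → L.sorts} (φ : Formula L (Sum.elim x y))
    (a : ℕ → M.Tuple x) {p : M.Tuple y → ℝ}
    (hp : ∀ b, Tendsto (fun n => φ.interp M (a n) b) (hyperfilter ℕ) (𝓝 (p b))) :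
    p ∈ contTypes φ.interp M := by
  refine ⟨M.ultrapower, M.diagonal, Structure.isElementary_diagonal,
    fun i => Structure.Seq.toUltrapower (M := M) fun n => a n i, fun b => ?_⟩
  let e : ∀ o, M.Seq (Sum.elim x y o)
    | .inl i => fun n => a n i
    | .inr i => fun _ => b i
  refine tendsto_nhds_unique (hp b) ?_
  convert φ.tendsto_eval_ultrapower e using 2 with n
  · simp only [Formula.interp]
    congr 1
    funext o
    cases o <;> rfl
  · simp only [Formula.interp]
    congr 1
    funext o
    cases o <;> rfl

end Ultrapower

/-! ### Values of predicates at types -/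

section Values

variable {V W : Type v} {x : V → L.sorts} {y : W → L.sorts} {M : Structure.{l, w} L}
  {φ : Interp.{l, v, w} x y}

theorem mem_contTypes_self (φ : Interp.{l, v, w} x y) (M : Structure.{l, w} L) (a : M.Tuple x) :
    φ M a ∈ contTypes φ M :=
  ⟨M, fun _ a => a, fun _ _ _ => rfl, a, fun _ => rfl⟩

theorem contTypes_subset_affTypes (φ : Interp.{l, v, w} x y) (M : Structure.{l, w} L) :
    contTypes φ M ⊆ affTypes φ M := fun _ ⟨N, j, hj, a, ha⟩ =>
  ⟨N, j, fun z θ _ => hj z θ, a, ha⟩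

/-- `ψ` takes the value of the limit at limits of types of points. -/
theorem AffValue.eq_of_tendsto {ψ : M.Tuple x → ℝ} {p : M.Tuple y → ℝ} {r s : ℝ}
    (h : AffValue φ M ψ p r) {ι : Type*} {F : Filter ι} [F.NeBot] {a : ι → M.Tuple x}
    (hp : ∀ b, Tendsto (fun n => φ M (a n) b) F (𝓝 (p b)))
    (hs : Tendsto (fun n => ψ (a n)) F (𝓝 s)) : r = s := by
  refine eq_of_forall_dist_le fun ε hε => ?_
  obtain ⟨n, c, α, b, h1, h2⟩ := h (ε / 2) (half_pos hε)
  have h3 := le_of_tendsto' (hs.sub ((tendsto_finsetSum Finset.univ fun i _ =>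
    (hp (b i)).const_mul (α i)).const_add c)).abs fun n => h1 (a n)
  rw [Real.dist_eq]
  have := abs_sub_le r (c + ∑ i, α i * p (b i)) s
  rw [abs_sub_comm] at h3
  linarith

theorem ContValue.eq_of_tendsto {ψ : M.Tuple x → ℝ} {p : M.Tuple y → ℝ} {r s : ℝ}
    (h : ContValue φ M ψ p r) (hpm : p ∈ contTypes φ M) {ι : Type*} {F : Filter ι} [F.NeBot]
    {a : ι → M.Tuple x} (hp : ∀ b, Tendsto (fun n => φ M (a n) b) F (𝓝 (p b)))
    (hs : Tendsto (fun n => ψ (a n)) F (𝓝 s)) : r = s := by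
  obtain ⟨f, ⟨hf, hfψ⟩, rfl⟩ := h
  have h1 : Tendsto (fun n => φ M (a n)) F (𝓝[contTypes φ M] p) :=
    tendsto_nhdsWithin_iff.2 ⟨tendsto_pi_nhds.2 hp,
      Eventually.of_forall fun n => mem_contTypes_self φ M (a n)⟩
  refine tendsto_nhds_unique ((hf p hpm).tendsto.comp h1) (hs.congr fun n => ?_)
  exact (hfψ (a n)).symm

/-- Affine values at continuous types give a continuous extension. -/
theorem contExtends_of_affValue (hcl : contTypes φ M ⊆ closure (Set.range (φ M)))
    {ψ : M.Tuple x → ℝ} {f : (M.Tuple y → ℝ) → ℝ}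
    (hf : ∀ p ∈ contTypes φ M, AffValue φ M ψ p (f p)) : ContExtends φ M ψ f := by
  have hfψ : ∀ a, f (φ M a) = ψ a := fun a =>
    (hf _ (mem_contTypes_self φ M a)).eq_of_tendsto (F := (⊤ : Filter Unit)) (a := fun _ => a)
      (fun _ => tendsto_const_nhds) tendsto_const_nhds
  refine ⟨?_, hfψ⟩
  rcases isEmpty_or_nonempty (M.Tuple x) with hx | ⟨⟨a₀⟩⟩
  · have : contTypes φ M = ∅ := by
      rw [Set.range_eq_empty, closure_empty] at hcl
      exact Set.subset_empty_iff.1 hcl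
    rw [this]
    exact continuousOn_empty f
  refine continuousOn_of_uniform_approx_of_continuousOn fun u hu => ?_
  obtain ⟨ε, hε, hεu⟩ := Metric.mem_uniformity_dist.1 hu
  -- The point `a₀` only serves to extract a combination uniformly close to `ψ` on `M^x`.
  obtain ⟨n, c, α, b, h1, -⟩ := hf _ (mem_contTypes_self φ M a₀) (ε / 2) (half_pos hε)
  refine ⟨fun p => c + ∑ i, α i * p (b i), by fun_prop, fun p hp => hεu ?_⟩
  rw [Real.dist_eq]
  refine lt_of_le_of_lt (b := ε / 2) ?_ (half_lt_self hε)
  have hne := mem_closure_iff_comap_neBot.1 (hcl hp)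
  set F := comap (Subtype.val : Set.range (φ M) → M.Tuple y → ℝ) (𝓝 p)
  choose a ha using fun q : Set.range (φ M) => q.2
  have hpF : ∀ b, Tendsto (fun q => φ M (a q) b) F (𝓝 (p b)) := by
    simp only [ha]
    exact tendsto_pi_nhds.1 tendsto_comap
  -- A second combination, adapted to `p`, is close to the first on points of `M`, hence at their
  -- limit `p`.
  have hbd : ∀ δ > 0, |f p - (c + ∑ i, α i * p (b i))| ≤ ε / 2 + δ := by
    intro δ hδ
    obtain ⟨m, c', α', b', h1', h2'⟩ := hf p hp (δ / 2) (half_pos hδ)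
    have hlim : |(c' + ∑ i, α' i * p (b' i)) - (c + ∑ i, α i * p (b i))| ≤ ε / 2 + δ / 2 := by
      refine le_of_tendsto' ((((tendsto_finsetSum Finset.univ fun i _ =>
        (hpF (b' i)).const_mul (α' i)).const_add c').sub ((tendsto_finsetSum Finset.univ fun i _ =>
        (hpF (b i)).const_mul (α i)).const_add c))).abs fun q => ?_
      have e1 := h1 (a q)
      have e2 := h1' (a q)
      rw [abs_le] at e1 e2 ⊢
      constructor <;> linarith [e1.1, e1.2, e2.1, e2.2]
    rw [abs_le] at h2' hlim ⊢
    constructor <;> linarith [h2'.1, h2'.2, hlim.1, hlim.2]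
  exact le_of_forall_pos_le_add hbd

theorem IsMeanPredicate.isAffPredicate {ψ : M.Tuple x → ℝ} (h : IsMeanPredicate φ M ψ) :
    IsAffPredicate φ M ψ := fun ε hε => by
  obtain ⟨n, α, b, -, -, h⟩ := h ε hε
  exact ⟨n, 0, α, b, by simpa using h⟩

/-- Convex weights do not amplify errors, whereas general affine coefficients could; this is what
mean-definability adds. -/
theorem abs_sum_mul_sub_le {n : ℕ} {α : Fin n → ℝ} (h0 : ∀ i, 0 ≤ α i) (h1 : ∑ i, α i = 1)
    {u v : Fin n → ℝ} {ε : ℝ} (h : ∀ i, |u i - v i| ≤ ε) :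
    |∑ i, α i * u i - ∑ i, α i * v i| ≤ ε := by
  rw [← Finset.sum_sub_distrib]
  calc |∑ i, (α i * u i - α i * v i)| ≤ ∑ i, |α i * u i - α i * v i| :=
        Finset.abs_sum_le_sum_abs _ _
    _ ≤ ∑ i, α i * ε := Finset.sum_le_sum fun i _ => by
        rw [← mul_sub, abs_mul, abs_of_nonneg (h0 i)]
        exact mul_le_mul_of_nonneg_left (h i) (h0 i)
    _ = ε := by rw [← Finset.sum_mul, h1, one_mul]

/-- Mean-definable types have a common value at each other. -/
theorem exists_affValue_of_isMeanPredicate {p : M.Tuple y → ℝ} {q : M.Tuple x → ℝ}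
    (hp : IsMeanPredicate φ.op M p) (hq : IsMeanPredicate φ M q) :
    ∃ r, AffValue φ.op M p q r ∧ AffValue φ M q p r := by
  have hpos : ∀ k : ℕ, (0 : ℝ) < 1 / (k + 1) := fun k => Nat.one_div_pos_of_nat
  choose n α a α0 α1 hα using fun k : ℕ => hp (1 / (k + 1)) (hpos k)
  choose m β b β0 β1 hβ using fun k : ℕ => hq (1 / (k + 1)) (hpos k)
  let A : ℕ → ℝ := fun k => ∑ i, α k i * q (a k i)
  let B : ℕ → ℝ := fun k => ∑ i, β k i * p (b k i)
  -- Both are compared with the double sum of the values `φ(aᵢ, bⱼ)`.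
  have hAB : ∀ k k' : ℕ, |A k - B k'| ≤ 1 / ((k' : ℝ) + 1) + 1 / ((k : ℝ) + 1) := by
    intro k k'
    have h1 := abs_sum_mul_sub_le (α0 k) (α1 k) fun i => hβ k' (a k i)
    have h2 := abs_sum_mul_sub_le (β0 k') (β1 k') fun i => hα k (b k' i)
    have e : ∑ i, α k i * ∑ j, β k' j * φ M (a k i) (b k' j) =
        ∑ j, β k' j * ∑ i, α k i * φ.op M (b k' j) (a k i) := by
      simp only [Finset.mul_sum, Interp.op]
      rw [Finset.sum_comm]
      simp only [mul_left_comm]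
    rw [e] at h1
    refine (abs_sub_le _ _ _).trans (add_le_add h1 ?_)
    rw [abs_sub_comm]
    exact h2
  have hlim : Tendsto (fun k : ℕ => 1 / ((k : ℝ) + 1)) (hyperfilter ℕ) (𝓝 0) :=
    tendsto_one_div_add_atTop_nhds_zero_nat.mono_left Nat.hyperfilter_le_atTop
  obtain ⟨r, -, hr⟩ := exists_tendsto_of_bounded (hyperfilter ℕ) (f := A) (C := |B 0| + 2) (by
    intro k
    have h1 := hAB k 0
    have h2 : 1 / ((k : ℝ) + 1) ≤ 1 := by
      rw [div_le_one (by positivity)]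
      have : (0 : ℝ) ≤ k := k.cast_nonneg
      linarith
    have h3 := abs_sub_abs_le_abs_sub (A k) (B 0)
    norm_num at h1 h2 h3 ⊢
    linarith)
  have hB : ∀ k', |r - B k'| ≤ 1 / ((k' : ℝ) + 1) := fun k' => by
    simpa using le_of_tendsto_of_tendsto' (hr.sub_const (B k')).abs (hlim.const_add _)
      fun k => hAB k k'
  have hBr : Tendsto B (hyperfilter ℕ) (𝓝 r) :=
    tendsto_iff_dist_tendsto_zero.2 (squeeze_zero (fun _ => dist_nonneg) (fun k => by
      rw [dist_comm]; exact hB k) hlim)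
  have hA : ∀ k, |r - A k| ≤ 1 / ((k : ℝ) + 1) := fun k => by
    rw [abs_sub_comm]
    simpa using le_of_tendsto_of_tendsto' (hBr.const_sub (A k)).abs (hlim.add_const _)
      fun k' => hAB k k'
  refine ⟨r, fun ε hε => ?_, fun ε hε => ?_⟩ <;> obtain ⟨k, hk⟩ := exists_nat_one_div_lt hε
  · refine ⟨n k, 0, α k, a k, fun c => ?_, ?_⟩
    · rw [zero_add]; exact (hα k c).trans hk.le
    · rw [zero_add]; exact (hA k).trans hk.le
  · refine ⟨m k, 0, β k, b k, fun c => ?_, ?_⟩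
    · rw [zero_add]; exact (hβ k c).trans hk.le
    · rw [zero_add]; exact (hB k).trans hk.le

end Values

/-! ### Stability and definability of types -/

section Stability

variable {V W : Type v} {x : V → L.sorts} {y : W → L.sorts} {M : Structure.{l, w} L}
  {φ : Formula L (Sum.elim x y)}

theorem Formula.exists_interp_bound (φ : Formula L (Sum.elim x y)) (M : Structure.{l, w} L) :
    ∃ C : ℝ, ∀ a b, |φ.interp M a b| ≤ C := by
  obtain ⟨C, hC⟩ := φ.exists_bound
  exact ⟨C, fun a b => hC M _⟩

/-- If the values of types at each other, in a sense compatible with limits, do not depend on the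
order, then `φ` is stable. -/
theorem isStable_of_forall_value {R : (M.Tuple y → ℝ) → (M.Tuple x → ℝ) → ℝ → Prop}
    {R' : (M.Tuple x → ℝ) → (M.Tuple y → ℝ) → ℝ → Prop}
    (hR : ∀ p, ∀ q ∈ contTypes φ.interp.op M, ∀ (b : ℕ → M.Tuple y) (r s : ℝ), R p q r →
      (∀ a, Tendsto (fun n => φ.interp M a (b n)) (hyperfilter ℕ) (𝓝 (q a))) →
      Tendsto (fun n => p (b n)) (hyperfilter ℕ) (𝓝 s) → r = s)
    (hR' : ∀ q, ∀ p ∈ contTypes φ.interp M, ∀ (a : ℕ → M.Tuple x) (r s : ℝ), R' q p r →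
      (∀ b, Tendsto (fun n => φ.interp M (a n) b) (hyperfilter ℕ) (𝓝 (p b))) →
      Tendsto (fun n => q (a n)) (hyperfilter ℕ) (𝓝 s) → r = s)
    (h : ∀ p ∈ contTypes φ.interp M, ∀ q ∈ contTypes φ.interp.op M, ∃ r, R p q r ∧ R' q p r) :
    IsStable φ.interp M := by
  intro a b f g r s hf hr hg hs
  have hW : (hyperfilter ℕ : Filter ℕ) ≤ atTop := Nat.hyperfilter_le_atTop
  obtain ⟨C, hC⟩ := φ.exists_interp_bound M
  choose p hp1 hp using fun b => exists_tendsto_of_bounded (hyperfilter ℕ)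
    (f := fun n => φ.interp M (a n) b) (fun n => hC (a n) b)
  choose q hq1 hq using fun a => exists_tendsto_of_bounded (hyperfilter ℕ)
    (f := fun n => φ.interp M a (b n)) (fun n => hC a (b n))
  have hpm := mem_contTypes_of_tendsto φ a hp
  have hqm : q ∈ contTypes φ.interp.op M := by
    rw [← Formula.interp_op]
    refine mem_contTypes_of_tendsto φ.op b ?_
    rw [Formula.interp_op]
    exact hq
  -- Thus `r` is the limit of `q` along points tending to `p`, and `s` that of `p` along points
  -- tending to `q`.
  have hfq : f = fun n => q (a n) := funext fun n =>
    tendsto_nhds_unique ((hf n).mono_left hW) (hq (a n))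
  have hgp : g = fun n => p (b n) := funext fun n =>
    tendsto_nhds_unique ((hg n).mono_left hW) (hp (b n))
  obtain ⟨t, ht, ht'⟩ := h p hpm q hqm
  rw [← hR' q p hpm a t r ht' hp (hfq ▸ hr.mono_left hW),
    ← hR p q hqm b t s ht hq (hgp ▸ hs.mono_left hW)]

theorem isStable_of_affValue (h : ∀ p ∈ contTypes φ.interp M, ∀ q ∈ contTypes φ.interp.op M,
    ∃ r, AffValue φ.interp.op M p q r ∧ AffValue φ.interp M q p r) : IsStable φ.interp M :=
  isStable_of_forall_value (R := AffValue φ.interp.op M) (R' := AffValue φ.interp M)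
    (fun _ _ _ _ _ _ hr hq hs => hr.eq_of_tendsto hq hs)
    (fun _ _ _ _ _ _ hr hp hs => hr.eq_of_tendsto hp hs) h

theorem ContTypesDefinableSymm.isStable (h : ContTypesDefinableSymm φ.interp M) :
    IsStable φ.interp M :=
  isStable_of_forall_value (R := ContValue φ.interp.op M) (R' := ContValue φ.interp M)
    (fun _ _ hqm _ _ _ hr hq hs => hr.eq_of_tendsto hqm hq hs)
    (fun _ _ hpm _ _ _ hr hp hs => hr.eq_of_tendsto hpm hp hs) h.2.2

/-- The common values `r p q` of mean-definable types, with either argument fixed, are the required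
continuous extensions. -/
theorem ContTypesMeanDefinable.contTypesDefinableSymm (h : ContTypesMeanDefinable φ.interp M) :
    ContTypesDefinableSymm φ.interp M := by
  have hv : ∀ p ∈ contTypes φ.interp M, ∀ q ∈ contTypes φ.interp.op M,
      ∃ r, AffValue φ.interp.op M p q r ∧ AffValue φ.interp M q p r := fun p hp q hq =>
    exists_affValue_of_isMeanPredicate (h.1 p hp) (h.2 q hq)
  choose! r hr hr' using hv
  have hcl : contTypes φ.interp M ⊆ closure (Set.range (φ.interp M)) := fun p hp =>
    mem_closure_of_mem_contTypes φ hp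
  have hcl' : contTypes φ.interp.op M ⊆ closure (Set.range (φ.interp.op M)) := by
    rw [← Formula.interp_op]
    exact fun p hp => mem_closure_of_mem_contTypes φ.op hp
  have hp : ∀ p ∈ contTypes φ.interp M, ContExtends φ.interp.op M p (r p) := fun p hp =>
    contExtends_of_affValue hcl' fun q hq => hr p hp q hq
  have hq : ∀ q ∈ contTypes φ.interp.op M, ContExtends φ.interp M q fun p => r p q := fun q hq =>
    contExtends_of_affValue hcl fun p hp => hr' p hp q hq
  exact ⟨fun p h => ⟨_, hp p h⟩, fun q h => ⟨_, hq q h⟩,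
    fun p h q h' => ⟨r p q, ⟨_, hp p h, rfl⟩, ⟨_, hq q h', rfl⟩⟩⟩

theorem AffTypesMeanDefinable.affTypesDefinableSymm (h : AffTypesMeanDefinable φ.interp M) :
    AffTypesDefinableSymm φ.interp M :=
  ⟨fun p hp => (h.1 p hp).isAffPredicate, fun q hq => (h.2 q hq).isAffPredicate,
    fun p hp q hq => exists_affValue_of_isMeanPredicate (h.1 p hp) (h.2 q hq)⟩

theorem AffTypesMeanDefinable.contTypesMeanDefinable (h : AffTypesMeanDefinable φ.interp M) :
    ContTypesMeanDefinable φ.interp M :=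
  ⟨fun p hp => h.1 p (contTypes_subset_affTypes _ _ hp),
    fun q hq => h.2 q (contTypes_subset_affTypes _ _ hq)⟩

theorem AffTypesDefinableSymm.isStable (h : AffTypesDefinableSymm φ.interp M) :
    IsStable φ.interp M :=
  isStable_of_affValue fun p hp q hq =>
    h.2.2 p (contTypes_subset_affTypes _ _ hp) q (contTypes_subset_affTypes _ _ hq)

theorem IsStable.op (h : IsStable φ.interp M) : IsStable φ.op.interp M := by
  rw [Formula.interp_op]
  exact DoubleLimit.flip h

/-- If `φ` is stable in `M`, then every pointwise limit of convex combinations of types of points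
is mean-definable. -/
theorem IsStable.isMeanPredicate (h : IsStable φ.interp M) {p : M.Tuple y → ℝ}
    (hp : p ∈ closure (convexHull ℝ (Set.range (φ.interp M)))) :
    IsMeanPredicate φ.interp.op M p := by
  intro ε hε
  obtain ⟨C, hC⟩ := φ.exists_interp_bound M
  obtain ⟨θ, hθ, hle⟩ := DoubleLimit.exists_abs_sub_le_of_mem_closure (φ := φ.interp M) h hC hp hε
  obtain ⟨n, α, a, h0, h1, rfl⟩ := mem_convexHull_range_iff.1 hθ
  exact ⟨n, α, a, h0, h1, fun b => by simpa [Interp.op] using hle b⟩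

theorem IsStable.contTypesMeanDefinable (h : IsStable φ.interp M) :
    ContTypesMeanDefinable φ.interp M := by
  -- Stated for all formulas so that it also applies to `φ.op`.
  have key : ∀ {V W : Type v} {x : V → L.sorts} {y : W → L.sorts} {φ : Formula L (Sum.elim x y)},
      IsStable φ.interp M → ∀ p ∈ contTypes φ.interp M, IsMeanPredicate φ.interp.op M p :=
    fun h p hp => h.isMeanPredicate
      (closure_mono (subset_convexHull ℝ _) (mem_closure_of_mem_contTypes _ hp))
  have := key h.op
  rw [Formula.interp_op] at this
  exact ⟨key h, this⟩

theorem IsStable.affTypesMeanDefinable (h : IsStable φ.interp M) (hφ : φ.IsAffine) :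
    AffTypesMeanDefinable φ.interp M := by
  have key : ∀ {V W : Type v} {x : V → L.sorts} {y : W → L.sorts} {φ : Formula L (Sum.elim x y)},
      IsStable φ.interp M → φ.IsAffine → ∀ p ∈ affTypes φ.interp M,
        IsMeanPredicate φ.interp.op M p :=
    fun h hφ p hp => h.isMeanPredicate (mem_closure_convexHull_of_mem_affTypes _ hφ hp)
  have := key h.op (hφ.subst _)
  rw [Formula.interp_op] at this
  exact ⟨key h hφ, this⟩

end Stability

end ContLogic

theorem mainTheorem1 {L : ContLogic.Language.{l}}
    (M : ContLogic.Structure.{l, max v w} L) {V W : Type v} (x : V → L.sorts) (y : W → L.sorts)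
    (φ : ContLogic.Formula L (Sum.elim x y)) :
    List.TFAE [
      ContLogic.IsStable φ.interp M,
      ContLogic.ContTypesDefinableSymm φ.interp M,
      ContLogic.ContTypesMeanDefinable φ.interp M] ∧
    (φ.IsAffine → List.TFAE [
      ContLogic.IsStable φ.interp M,
      ContLogic.ContTypesDefinableSymm φ.interp M,
      ContLogic.ContTypesMeanDefinable φ.interp M,
      ContLogic.AffTypesDefinableSymm φ.interp M,
      ContLogic.AffTypesMeanDefinable φ.interp M]) := by
  refine ⟨?_, fun hφ => ?_⟩
  · tfae_have 1 → 3 := fun h => h.contTypesMeanDefinable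
    tfae_have 3 → 2 := fun h => h.contTypesDefinableSymm
    tfae_have 2 → 1 := fun h => h.isStable
    tfae_finish
  · tfae_have 1 → 5 := fun h => h.affTypesMeanDefinable hφ
    tfae_have 5 → 3 := fun h => h.contTypesMeanDefinable
    tfae_have 3 → 2 := fun h => h.contTypesDefinableSymm
    tfae_have 2 → 1 := fun h => h.isStable
    tfae_have 5 → 4 := fun h => h.affTypesDefinableSymm
    tfae_have 4 → 1 := fun h => h.isStable
    tfae_finish
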